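/- Let $N\in\mathbb N$, $\omega\in\mathbb R$, $\mathbb T=\mathbb R/2\pi\mathbb Z$. Let $\mathbf K_N$ be the directed graph on $\{1,\dots,N\}$ with all edges $(j,k)$, $j\neq k$, and let $\mathbf H$ be a subgraph of $\mathbf K_N$ with the same vertex set (any set of edges $(j,k)$, $j\ne k$). Definitions. A \emph{spanning diverging tree} of $\mathbf H$ is a subgraph of $\mathbf H$ on all $N$ vertices whose underlying undirected graph is connected, in which one vertex (the root) has no incoming edge and every other vertex has exactly one incoming edge. A \emph{coupling function} is a smooth non-constant function $g:\mathbb T\to\mathbb R$. Let $\mathrm{DZ}(g)$ be the set of points that have an open neighbourhood on which $g$ vanishes identically; its connected components are the dead zones of $g$. The function $g$ has \emph{simple dead zones} if $\mathrm{DZ}(g)$ has finitely many connected components and every point at which $g$ is locally constant lies in $\mathrm{DZ}(g)$. The \emph{all-to-all network} is $$\dot\theta_k=\omega+\sum_{j\neq k} g(\theta_j-\theta_k),\qquad k=1,\dots,N,\quad \theta\in\mathbb T^N .$$ The \emph{effective coupling graph} $\mathcal G_g(\theta)$ at $\theta\in\mathbb T^N$ is the directed graph on $\{1,\dots,N\}$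 with edges $\{(j,k): j\ne k,\ \theta_j-\theta_k\notin \mathrm{DZ}(g)\}$. A set $S\subset\mathbb T^N$ is \emph{asymptotically stable} if for every $\varepsilon>0$ there is $\delta>0$ such that solutions starting in the $\delta$-neighbourhood of $S$ stay in its $\varepsilon$-neighbourhood for all $t\ge 0$, and there is $\delta>0$ such that all solutions starting in the $\delta$-neighbourhood of $S$ satisfy $\operatorname{dist}(\theta(t),S)\to0$ as $t\to\infty$. A solution $(\Omega t+\theta^o_1,\dots,\Omega t+\theta^o_N)$ is called a \emph{relative equilibrium}; it is \emph{locally asymptotically stable} if the phase-shift orbit $\{(\theta^o_1+c,\dots,\theta^o_N+c):c\in\mathbb T\}$ is asymptotically stable. Proposition. If $\mathbf H$ admits a spanning diverging tree, then there is a coupling function $g$ with simple dead zones, and with at least one dead zone, such that the all-to-all network has a locally asymptotically stable relative equilibrium $(\Omega t+\theta^o_1,\dots,\Omega t+\theta^o_N)$, for some $\Omega\in\mathbb R$ and $\theta^o\in\mathbb T^N$, satisfying $\mathcal G_g(\theta^o)=\mathbf H$. Moreover $g$ stably realises $\mathbf H$: there is a non-empty, open, forward invariant, asymptotically stable set $B\subset\mathbb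 T^N$ with $\mathcal G_g(\theta)=\mathbf H$ for all $\theta\in B$. -/

import Mathlib

namespace DeadZones

open Real Filter Topology

/-! ### Coupling functions on the circle `ℝ / 2πℤ` and their dead zones -/

/-- A coupling function: a smooth, non-constant real function on the circle `ℝ / 2πℤ`
(smoothness is that of the `2π`-periodic function on the line). -/
structure IsCouplingFunction (g : Real.Angle → ℝ) : Prop where
  smooth : ContDiff ℝ (⊤ : ℕ∞) (fun x : ℝ => g (x : Real.Angle))
  nonconstant : ¬ ∃ c : ℝ, ∀ x, g x = c

/-- `LC(g)`: the points at which `g` is locally constant. -/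
def locallyConstantSet (g : Real.Angle → ℝ) : Set Real.Angle :=
  {x | ∃ c : ℝ, ∃ U : Set Real.Angle, IsOpen U ∧ x ∈ U ∧ ∀ y ∈ U, g y = c}

/-- `DZ(g)`: the points at which `g` is locally null. -/
def deadZoneSet (g : Real.Angle → ℝ) : Set Real.Angle :=
  {x | ∃ U : Set Real.Angle, IsOpen U ∧ x ∈ U ∧ ∀ y ∈ U, g y = 0}

/-- `g` has simple dead zones: `DZ(g)` has finitely many connected components, and `g` is locally
constant only where it is locally null. -/
structure HasSimpleDeadZones (g : Real.Angle → ℝ) : Prop where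
  finite_components : Finite (ConnectedComponents (deadZoneSet g))
  locallyConstant_eq : locallyConstantSet g = deadZoneSet g

/-! ### Directed graphs; `Adj j k` is an edge from `j` to `k` -/

/-- The fully connected graph `K_N`: all edges `(j, k)` with `j ≠ k`. -/
def fullyConnectedGraph (N : ℕ) : Digraph (Fin N) where
  Adj j k := j ≠ k

/-- `T` is a diverging tree on all vertices: its underlying undirected graph is connected, one
vertex (the root) has no incoming edge and every other vertex has exactly one. -/
def IsDivergingTree {N : ℕ} (T : Digraph (Fin N)) : Prop :=
  T.toSimpleGraphInclusive.Connected ∧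
    ∃ r, (∀ j, ¬ T.Adj j r) ∧ ∀ k, k ≠ r → ∃! j, T.Adj j k

/-- `H` admits a spanning diverging tree. -/
def HasSpanningDivergingTree {N : ℕ} (H : Digraph (Fin N)) : Prop :=
  ∃ T : Digraph (Fin N), T ≤ H ∧ IsDivergingTree T

/-- The effective coupling graph at `θ` of the all-to-all network with coupling function `g`. -/
def effectiveCouplingGraph {N : ℕ} (g : Real.Angle → ℝ) (θ : Fin N → Real.Angle) :
    Digraph (Fin N) where
  Adj j k := j ≠ k ∧ θ j - θ k ∉ deadZoneSet g

/-! ### The all-to-all oscillator network -/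

/-- The right-hand side `ω + ∑_{j ≠ k} g (θ_j - θ_k)` of the network. -/
noncomputable def networkField {N : ℕ} (ω : ℝ) (g : Real.Angle → ℝ) (θ : Fin N → Real.Angle) (k : Fin N) : ℝ :=
  ω + ∑ j ∈ Finset.univ.erase k, g (θ j - θ k)

/-- The curve `θ` in the torus solves `θ_k' = ω + ∑_{j ≠ k} g (θ_j - θ_k)` on the time set `I`:
it has a lift `φ` to `ℝ^N` whose derivative is the right-hand side. -/
def IsSolutionOn {N : ℕ} (ω : ℝ) (g : Real.Angle → ℝ) (I : Set ℝ)
    (θ : ℝ → Fin N → Real.Angle) : Prop :=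
  ∃ φ : ℝ → Fin N → ℝ, ∀ t ∈ I, ∀ k,
    θ t k = (φ t k : Real.Angle) ∧
      HasDerivWithinAt (fun s => φ s k) (networkField ω g (θ t) k) I t

/-- `(Ω t + θ₁, …, Ω t + θ_N)` is a solution for all times. -/
def IsRelativeEquilibrium {N : ℕ} (ω : ℝ) (g : Real.Angle → ℝ) (Ω : ℝ)
    (θ : Fin N → Real.Angle) : Prop :=
  IsSolutionOn ω g Set.univ (fun t k => ((Ω * t : ℝ) : Real.Angle) + θ k)

/-- The orbit of `θ` under the phase shifts `(θ₁, …, θ_N) ↦ (θ₁ + c, …, θ_N + c)`. -/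
def phaseShiftOrbit {N : ℕ} (θ : Fin N → Real.Angle) : Set (Fin N → Real.Angle) :=
  Set.range fun (c : Real.Angle) (k : Fin N) => θ k + c

/-- Forward invariance of a set of states. -/
def IsForwardInvariant {N : ℕ} (ω : ℝ) (g : Real.Angle → ℝ)
    (S : Set (Fin N → Real.Angle)) : Prop :=
  ∀ θ, IsSolutionOn ω g (Set.Ici 0) θ → θ 0 ∈ S → ∀ t, 0 ≤ t → θ t ∈ S

/-- Asymptotic stability of a set of states: Lyapunov stability together with attraction of all
solutions that start in some `δ`-neighbourhood of the set. -/
def IsAsymptoticallyStable {N : ℕ} (ω : ℝ) (g : Real.Angle → ℝ)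
    (S : Set (Fin N → Real.Angle)) : Prop :=
  (∀ ε : ℝ, 0 < ε → ∃ δ : ℝ, 0 < δ ∧ ∀ θ, IsSolutionOn ω g (Set.Ici 0) θ →
      θ 0 ∈ Metric.thickening δ S → ∀ t, 0 ≤ t → θ t ∈ Metric.thickening ε S) ∧
    ∃ δ : ℝ, 0 < δ ∧ ∀ θ, IsSolutionOn ω g (Set.Ici 0) θ →
      θ 0 ∈ Metric.thickening δ S → Tendsto (fun t => Metric.infDist (θ t) S) atTop (𝓝 0)

/-- A locally asymptotically stable relative equilibrium: asymptotic stability is that of the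
equilibrium of the quotient by phase shifts, i.e. of the phase-shift orbit. -/
def IsStableRelativeEquilibrium {N : ℕ} (ω : ℝ) (g : Real.Angle → ℝ) (Ω : ℝ)
    (θ : Fin N → Real.Angle) : Prop :=
  IsRelativeEquilibrium ω g Ω θ ∧ IsAsymptoticallyStable ω g (phaseShiftOrbit θ)

/-- `g` stably realises `H`: some non-empty open, forward invariant, asymptotically stable set
consists of states with effective coupling graph `H`. -/
def StablyRealises {N : ℕ} (ω : ℝ) (g : Real.Angle → ℝ) (H : Digraph (Fin N)) : Prop :=
  ∃ B : Set (Fin N → Real.Angle), B.Nonempty ∧ IsOpen B ∧ IsForwardInvariant ω g B ∧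
    IsAsymptoticallyStable ω g B ∧ ∀ θ ∈ B, effectiveCouplingGraph g θ = H

end DeadZones

namespace DeadZones

open Real Filter Topology

/-! ### Elementary facts about the cosine -/

/-! Choose phases whose pairwise differences are all distinct, and build `g` from one narrow odd
bump per ordered pair of vertices, centred at the difference of that pair. The bumps do not overlap,
so near the chosen state every ordered pair feels only its own bump: the all-to-all network acts
there like a network with freely prescribed weights `W j k`, and weight zero puts a pair into a dead
zone. Weights supported exactly on `H` therefore yield the graph `H`
(`effectiveCouplingGraph_realisingCoupling`, from the exact description in
`AreSeparated.deadZoneSet_bumpSum`). Odd bumps vanish at their centres, so the state rotates rigidly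
with frequency `ω`.

For stability, edges of a spanning diverging tree get weight 1 and the other edges of `H` a small
weight `ε`. Along the tree each vertex is attracted by its parent. The energy summing `γ k * (ψ k -
ψ (p k)) ^ 2` decays: weights `γ` that shrink geometrically with depth absorb the motion of the
parent, and small `ε` absorbs the remaining edges (`treeEnergyDeriv_le`). Since the tree spans, the
energy bounds all phase differences, so its sublevels are neighbourhoods of the phase-shift orbit;
exponential decay on them stabilises both the orbit and a sublevel, which serves as `B`.

One further bump at `π` keeps `g` non-constant when `H` has no edges. All bumps stay away from `0`,
which gives a dead zone. -/

theorem abs_lt_of_cos_lt_cos {u ρ : ℝ} (hu : |u| ≤ π) (hρ : 0 ≤ ρ) (h : cos ρ < cos u) :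
    |u| < ρ := by
  by_contra! hle
  have := Real.cos_le_cos_of_nonneg_of_le_pi hρ hu hle
  rw [Real.cos_abs] at this
  linarith

theorem cos_lt_cos_of_abs_lt {u ρ : ℝ} (hρ : ρ ≤ π) (h : |u| < ρ) : cos ρ < cos u := by
  rw [← Real.cos_abs u]
  exact Real.cos_lt_cos_of_nonneg_of_le_pi (abs_nonneg u) hρ h

/-- The range `2 * π` is what differences of two representatives in `[-π, π]` need; beyond `π` the
reflection `2 * π - |v|` reduces to the monotone branch of the cosine. -/
theorem cos_lt_cos_iff_of_abs_le_two_pi {v ρ : ℝ} (hρ : 0 ≤ ρ) (hρ' : ρ ≤ π)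
    (hv : |v| ≤ 2 * π) : cos v < cos ρ ↔ ρ < |v| ∧ |v| < 2 * π - ρ := by
  have hrefl : cos (2 * π - |v|) = cos v := by rw [Real.cos_two_pi_sub, Real.cos_abs]
  constructor
  · intro h
    constructor
    · by_contra! hle
      have := Real.cos_le_cos_of_nonneg_of_le_pi (abs_nonneg v) hρ' hle
      rw [Real.cos_abs] at this
      linarith
    · by_contra! hle
      have := Real.cos_le_cos_of_nonneg_of_le_pi (x := 2 * π - |v|) (y := ρ) (by linarith) hρ'
        (by linarith)
      linarith
  · rintro ⟨h1, h2⟩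
    rcases le_total |v| π with h | h
    · rw [← Real.cos_abs v]
      exact Real.cos_lt_cos_of_nonneg_of_le_pi hρ h h1
    · rw [← hrefl]
      exact Real.cos_lt_cos_of_nonneg_of_le_pi hρ (by linarith) (by linarith)

/-- Two points of the circle within distance `arccos c` of a third one are within distance
`2 arccos c` of each other. -/
theorem lt_cos_sub_of_lt_cos_of_le_cos {c : ℝ} (hc : 0 < c) {x y : Real.Angle} (hx : c < x.cos)
    (hy : c ≤ y.cos) : 2 * c ^ 2 - 1 < (x - y).cos := by
  have h1 := x.cos_sq_add_sin_sq
  have h2 := y.cos_sq_add_sin_sq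
  rw [sub_eq_add_neg x y, Real.Angle.cos_add, Real.Angle.cos_neg, Real.Angle.sin_neg]
  have h3 : c ^ 2 < x.cos * y.cos := by nlinarith
  have h4 : (x.sin) ^ 2 ≤ 1 - c ^ 2 := by nlinarith
  have h5 : (y.sin) ^ 2 ≤ 1 - c ^ 2 := by nlinarith
  nlinarith [sq_nonneg (x.sin + y.sin)]

/-! ### A bump on the circle and superpositions of bumps -/

/-- A smooth odd function on the circle, supported on the arc of radius `ρ` around `0`. -/
noncomputable def oddBump (ρ : ℝ) (x : Real.Angle) : ℝ :=
  x.sin * expNegInvGlue (x.cos - cos ρ)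

theorem oddBump_zero (ρ : ℝ) : oddBump ρ 0 = 0 := by simp [oddBump]

theorem oddBump_neg (ρ : ℝ) (x : Real.Angle) : oddBump ρ (-x) = -oddBump ρ x := by
  simp [oddBump]

theorem oddBump_eq_zero {ρ : ℝ} {x : Real.Angle} (h : x.cos ≤ cos ρ) : oddBump ρ x = 0 := by
  simp [oddBump, expNegInvGlue.zero_of_nonpos (sub_nonpos.2 h)]

theorem expNegInvGlue_le_one (x : ℝ) : expNegInvGlue x ≤ 1 := by
  unfold expNegInvGlue
  split_ifs with h
  · exact zero_le_one
  · exact Real.exp_le_one_iff.2 (neg_nonpos.2 (inv_nonneg.2 (not_le.1 h).le))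

theorem abs_oddBump_le (ρ u : ℝ) : |oddBump ρ (u : Real.Angle)| ≤ |u| := by
  rw [oddBump, abs_mul, abs_of_nonneg (expNegInvGlue.nonneg _), Real.Angle.sin_coe]
  calc |sin u| * _ ≤ |sin u| * 1 := by gcongr; exact expNegInvGlue_le_one _
    _ ≤ |u| := by rw [mul_one]; exact Real.abs_sin_le_abs

/-- Near its centre the bump has a linear lower bound. -/
theorem exists_mul_sq_le_mul_oddBump {ρ : ℝ} (hρ : 0 < ρ) (hρ' : ρ ≤ π / 2) :
    ∃ a : ℝ, 0 < a ∧ a ≤ 1 ∧ ∀ u : ℝ, |u| ≤ ρ / 2 →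
      a * u ^ 2 ≤ u * oddBump ρ (u : Real.Angle) := by
  have hcos : 0 < cos (ρ / 2) - cos ρ := sub_pos.2
    (Real.cos_lt_cos_of_nonneg_of_le_pi (by linarith) (by linarith [Real.pi_pos]) (by linarith))
  set E := expNegInvGlue (cos (ρ / 2) - cos ρ) with hE
  have hE0 : 0 < E := expNegInvGlue.pos_of_pos hcos
  have hE1 : E ≤ 1 := expNegInvGlue_le_one _
  have h2π : 2 / π ≤ 1 := (div_le_one Real.pi_pos).2 Real.two_le_pi
  have h2π0 : 0 < 2 / π := div_pos two_pos Real.pi_pos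
  refine ⟨2 / π * E, mul_pos h2π0 hE0, mul_le_one₀ h2π hE0.le hE1, fun u hu => ?_⟩
  have hcu : cos (ρ / 2) ≤ cos u := by
    rw [← Real.cos_abs u]
    exact Real.cos_le_cos_of_nonneg_of_le_pi (abs_nonneg u) (by linarith [Real.pi_pos]) hu
  have hEu : E ≤ expNegInvGlue (cos u - cos ρ) := expNegInvGlue.monotone (by linarith)
  have hsin : 2 / π * u ^ 2 ≤ u * sin u := by
    have hs : u * sin u = |u| * |sin u| := by
      rw [← abs_mul, abs_of_nonneg]
      rcases le_total 0 u with h | h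
      · rw [abs_of_nonneg h] at hu
        exact mul_nonneg h (Real.sin_nonneg_of_nonneg_of_le_pi h (by linarith [Real.pi_pos]))
      · rw [abs_of_nonpos h] at hu
        exact mul_nonneg_of_nonpos_of_nonpos h
          (Real.sin_nonpos_of_nonpos_of_neg_pi_le h (by linarith [Real.pi_pos]))
    rw [hs, ← sq_abs u]
    have := Real.mul_abs_le_abs_sin (x := u) (by linarith)
    nlinarith [abs_nonneg u]
  simp only [oddBump, Real.Angle.sin_coe, Real.Angle.cos_coe]
  calc 2 / π * E * u ^ 2 = (2 / π * u ^ 2) * E := by ring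
    _ ≤ (u * sin u) * expNegInvGlue (cos u - cos ρ) := by
        have : 0 ≤ 2 / π * u ^ 2 := by positivity
        have := this.trans hsin
        gcongr
    _ = _ := by ring

/-- A weighted superposition of translated bumps. -/
noncomputable def bumpSum {ι : Type*} [Fintype ι] (ρ : ℝ) (w d : ι → ℝ) (x : Real.Angle) : ℝ :=
  ∑ i, w i * oddBump ρ (x - (d i : Real.Angle))

theorem contDiff_bumpSum {ι : Type*} [Fintype ι] (ρ : ℝ) (w d : ι → ℝ) :
    ContDiff ℝ (⊤ : ℕ∞) (fun x : ℝ => bumpSum ρ w d (x : Real.Angle)) := by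
  unfold bumpSum oddBump
  simp only [← Real.Angle.coe_sub, Real.Angle.sin_coe, Real.Angle.cos_coe]
  refine ContDiff.sum fun i _ => contDiff_const.mul (ContDiff.mul ?_ ?_)
  · exact Real.contDiff_sin.comp (contDiff_id.sub contDiff_const)
  · exact expNegInvGlue.contDiff.comp
      ((Real.contDiff_cos.comp (contDiff_id.sub contDiff_const)).sub contDiff_const)

/-! ### Dead zones of a superposition of disjoint bumps -/

section Superposition

variable {ι : Type*} {ρ : ℝ} {w d : ι → ℝ}

/-- Centres of bumps at mutual distance at least `2ρ` on the circle. -/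
def AreSeparated (ρ : ℝ) (d : ι → ℝ) : Prop :=
  ∀ i i', i ≠ i' → cos (d i - d i') ≤ 2 * cos ρ ^ 2 - 1

/-- A point within `ρ` of two centres would put them at distance less than `2ρ`, and `2 * cos ρ ^ 2
- 1` is `cos (2ρ)`. -/
theorem AreSeparated.cos_sub_lt (hd : AreSeparated ρ d) (hc : 0 < cos ρ) {x : Real.Angle} {i i' : ι}
    (hi : cos ρ < (x - (d i : Real.Angle)).cos) (hne : i' ≠ i) :
    (x - (d i' : Real.Angle)).cos < cos ρ := by
  by_contra! h
  have h1 := lt_cos_sub_of_lt_cos_of_le_cos hc hi h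
  rw [sub_sub_sub_cancel_left, ← Real.Angle.coe_sub, Real.Angle.cos_coe] at h1
  linarith [hd i' i hne]

variable [Fintype ι]

theorem AreSeparated.bumpSum_eq (hd : AreSeparated ρ d) (hc : 0 < cos ρ) {x : Real.Angle} {i : ι}
    (hi : cos ρ < (x - (d i : Real.Angle)).cos) :
    bumpSum ρ w d x = w i * oddBump ρ (x - (d i : Real.Angle)) :=
  Finset.sum_eq_single i
    (fun i' _ hne => by rw [oddBump_eq_zero (hd.cos_sub_lt hc hi hne).le, mul_zero])
    (fun h => absurd (Finset.mem_univ i) h)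

theorem bumpSum_eq_zero {x : Real.Angle}
    (h : ∀ i, w i ≠ 0 → (x - (d i : Real.Angle)).cos ≤ cos ρ) : bumpSum ρ w d x = 0 := by
  refine Finset.sum_eq_zero fun i _ => ?_
  by_cases hw : w i = 0
  · rw [hw, zero_mul]
  · rw [oddBump_eq_zero (h i hw), mul_zero]

/-- On the support of a bump the superposition is analytic, hence nowhere locally constant. -/
theorem AreSeparated.cos_sub_le_of_mem_locallyConstantSet (hd : AreSeparated ρ d) (hρ : 0 < ρ)
    (hρ' : ρ < π / 2) {x : Real.Angle} (hx : x ∈ locallyConstantSet (bumpSum ρ w d)) {i : ι}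
    (hw : w i ≠ 0) : (x - (d i : Real.Angle)).cos ≤ cos ρ := by
  by_contra! hi
  have hc : 0 < cos ρ := Real.cos_pos_of_mem_Ioo ⟨by linarith [Real.pi_pos], hρ'⟩
  obtain ⟨C, U, hU, hxU, hconst⟩ := hx
  set F : ℝ → ℝ := fun t => w i * (sin t * exp (-(cos t - cos ρ)⁻¹)) with hF
  have hcosI : ∀ t ∈ Set.Ioo (-ρ) ρ, cos ρ < cos t := fun t ht =>
    cos_lt_cos_of_abs_lt (by linarith [Real.pi_pos]) (abs_lt.2 ht)
  have hgF : ∀ t ∈ Set.Ioo (-ρ) ρ, bumpSum ρ w d ((d i + t : ℝ) : Real.Angle) = F t := by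
    intro t ht
    have h0 := hcosI t ht
    have hsub : ((d i + t : ℝ) : Real.Angle) - (d i : Real.Angle) = (t : Real.Angle) := by
      rw [← Real.Angle.coe_sub, add_sub_cancel_left]
    rw [hd.bumpSum_eq hc (i := i) (by rw [hsub, Real.Angle.cos_coe]; exact h0), hsub, hF, oddBump,
      expNegInvGlue, Real.Angle.sin_coe, Real.Angle.cos_coe, if_neg (by linarith)]
  set u := (x - (d i : Real.Angle)).toReal with hu
  have hux : ((d i + u : ℝ) : Real.Angle) = x := by
    rw [Real.Angle.coe_add, hu, Real.Angle.coe_toReal, add_sub_cancel]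
  have huI : u ∈ Set.Ioo (-ρ) ρ := by
    refine abs_lt.1 (abs_lt_of_cos_lt_cos (Real.Angle.abs_toReal_le_pi _) hρ.le ?_)
    rwa [hu, Real.Angle.cos_toReal]
  -- Inside the open arc `expNegInvGlue` is a genuine exponential, so the identity theorem spreads
  -- local constancy to the whole arc, where `F` vanishes at `0` but not at `ρ / 2`.
  have hana : AnalyticOnNhd ℝ F (Set.Ioo (-ρ) ρ) := by
    intro t ht
    have h0 : cos t - cos ρ ≠ 0 := (sub_pos.2 (hcosI t ht)).ne'
    have h1 : AnalyticAt ℝ (fun t => cos t - cos ρ) t := Real.analyticAt_cos.sub analyticAt_const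
    exact analyticAt_const.mul (Real.analyticAt_sin.mul (h1.inv h0).neg.rexp)
  have hev : F =ᶠ[𝓝 u] fun _ => C := by
    have hcont : Continuous fun t : ℝ => ((d i + t : ℝ) : Real.Angle) :=
      Real.Angle.continuous_coe.comp (continuous_const.add continuous_id)
    filter_upwards [Ioo_mem_nhds huI.1 huI.2,
      (hU.preimage hcont).mem_nhds (by rw [Set.mem_preimage, hux]; exact hxU)] with t ht htU
    rw [← hgF t ht]
    exact hconst _ htU
  have heq := hana.eqOn_of_preconnected_of_eventuallyEq analyticOnNhd_const isPreconnected_Ioo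
    huI hev
  have h0 : F 0 = C := heq ⟨by linarith, hρ⟩
  have h1 : F (ρ / 2) = C := heq ⟨by linarith, by linarith⟩
  have hs : 0 < sin (ρ / 2) :=
    Real.sin_pos_of_pos_of_lt_pi (by linarith) (by linarith [Real.pi_pos])
  have h2 : F 0 = 0 := by simp [hF]
  have h3 : F (ρ / 2) ≠ 0 := mul_ne_zero hw (mul_ne_zero hs.ne' (Real.exp_ne_zero _))
  exact h3 (h1.trans (h0.symm.trans h2))

theorem deadZoneSet_subset_locallyConstantSet (g : Real.Angle → ℝ) :
    deadZoneSet g ⊆ locallyConstantSet g :=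
  fun _ ⟨U, hU, hx, h⟩ => ⟨0, U, hU, hx, h⟩

/-- Local constancy excludes the open support of every active bump, so the constant can only be
zero. -/
theorem AreSeparated.locallyConstantSet_bumpSum (hd : AreSeparated ρ d) (hρ : 0 < ρ)
    (hρ' : ρ < π / 2) :
    locallyConstantSet (bumpSum ρ w d) = deadZoneSet (bumpSum ρ w d) := by
  refine Set.Subset.antisymm (fun x hx => ?_) (deadZoneSet_subset_locallyConstantSet _)
  have h0 := bumpSum_eq_zero fun i hw =>
    hd.cos_sub_le_of_mem_locallyConstantSet (w := w) hρ hρ' hx (i := i) hw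
  obtain ⟨C, U, hU, hxU, h⟩ := hx
  refine ⟨U, hU, hxU, fun y hy => ?_⟩
  rw [h y hy, ← h x hxU, h0]

/-- The inequality is strict because at an endpoint of an active arc the function vanishes without
being locally null. -/
theorem AreSeparated.deadZoneSet_bumpSum (hd : AreSeparated ρ d) (hρ : 0 < ρ) (hρ' : ρ < π / 2) :
    deadZoneSet (bumpSum ρ w d) = {x | ∀ i, w i ≠ 0 → (x - (d i : Real.Angle)).cos < cos ρ} := by
  ext x
  constructor
  · intro hx i hw
    refine lt_of_le_of_ne (hd.cos_sub_le_of_mem_locallyConstantSet hρ hρ'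
      (deadZoneSet_subset_locallyConstantSet _ hx) hw) fun heq => ?_
    obtain ⟨U, hU, hxU, h⟩ := hx
    set u := (x - (d i : Real.Angle)).toReal with hu
    have hcosu : cos u = cos ρ := by rw [hu, Real.Angle.cos_toReal, heq]
    have huρ : |u| = ρ := by
      refine Real.injOn_cos ⟨abs_nonneg u, Real.Angle.abs_toReal_le_pi _⟩
        ⟨hρ.le, by linarith [Real.pi_pos]⟩ ?_
      rw [Real.cos_abs, hcosu]
    -- From the endpoint, move slightly towards the centre (`t < 1`): this stays in `U` but enters
    -- the open arc.
    have hcont : Continuous fun t : ℝ => ((d i + t * u : ℝ) : Real.Angle) :=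
      Real.Angle.continuous_coe.comp
        (continuous_const.add (continuous_id.mul continuous_const))
    have hmem : (fun t : ℝ => ((d i + t * u : ℝ) : Real.Angle)) ⁻¹' U ∈ 𝓝 (1 : ℝ) := by
      refine (hU.preimage hcont).mem_nhds ?_
      simp only [Set.mem_preimage, one_mul, Real.Angle.coe_add, hu, Real.Angle.coe_toReal,
        add_sub_cancel]
      exact hxU
    obtain ⟨t, htU, ht0, ht1⟩ := Filter.nonempty_of_mem
      (inter_mem (mem_nhdsWithin_of_mem_nhds hmem) (Ioo_mem_nhdsLT (zero_lt_one' ℝ)))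
    have hle := hd.cos_sub_le_of_mem_locallyConstantSet hρ hρ'
      (deadZoneSet_subset_locallyConstantSet _
        (⟨U, hU, htU, h⟩ : ((d i + t * u : ℝ) : Real.Angle) ∈ deadZoneSet (bumpSum ρ w d))) hw
    rw [← Real.Angle.coe_sub, add_sub_cancel_left, Real.Angle.cos_coe] at hle
    refine absurd (cos_lt_cos_of_abs_lt (u := t * u) (ρ := ρ) (by linarith [Real.pi_pos]) ?_)
      hle.not_gt
    rw [abs_mul, abs_of_pos ht0, huρ]
    nlinarith
  · intro hx
    refine ⟨{x | ∀ i, w i ≠ 0 → (x - (d i : Real.Angle)).cos < cos ρ}, ?_, hx,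
      fun y hy => bumpSum_eq_zero fun i hw => (hy i hw).le⟩
    have : {x : Real.Angle | ∀ i, w i ≠ 0 → (x - (d i : Real.Angle)).cos < cos ρ} =
        ⋂ i, {x | w i ≠ 0 → (x - (d i : Real.Angle)).cos < cos ρ} := by ext; simp
    rw [this]
    refine isOpen_iInter_of_finite fun i => ?_
    by_cases hw : w i = 0
    · simp [hw]
    · simp only [ne_eq, hw, not_false_eq_true, forall_true_left]
      exact isOpen_lt (Real.Angle.continuous_cos.comp (continuous_id.sub continuous_const))
        continuous_const

end Superposition

/-- A finite union of preconnected sets has finitely many connected components. -/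
theorem finite_connectedComponents_of_eq_iUnion {X κ : Type*} [TopologicalSpace X] [Finite κ]
    {S : Set X} {P : κ → Set X} (hS : S = ⋃ k, P k) (hP : ∀ k, IsPreconnected (P k)) :
    Finite (ConnectedComponents S) := by
  have hsub : ∀ k, P k ⊆ S := fun k => hS ▸ Set.subset_iUnion P k
  have hex : ∀ z : ConnectedComponents S, ∃ k, ∃ x : S, ConnectedComponents.mk x = z ∧ x.1 ∈ P k := by
    intro z
    obtain ⟨x, rfl⟩ := ConnectedComponents.surjective_coe z
    obtain ⟨k, hk⟩ := Set.mem_iUnion.1 (hS.subset x.2)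
    exact ⟨k, x, rfl, hk⟩
  choose κf hκ using hex
  refine Finite.of_injective κf fun z z' hzz => ?_
  obtain ⟨x, rfl, hx⟩ := hκ z
  obtain ⟨x', rfl, hx'⟩ := hκ z'
  rw [← hzz] at hx'
  generalize κf _ = k at hx hx'
  have hpre : IsPreconnected ((↑) ⁻¹' P k : Set S) := by
    rw [← Topology.IsInducing.subtypeVal.isPreconnected_image, Subtype.image_preimage_coe,
      Set.inter_eq_right.2 (hsub k)]
    exact hP k
  rw [ConnectedComponents.coe_eq_coe']
  exact hpre.subset_connectedComponent hx' hx

/-! ### Finiteness of the dead zones and non-constancy -/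

section Superposition

variable {ι : Type*} [Fintype ι] {ρ : ℝ} {w d : ι → ℝ}

theorem AreSeparated.hasSimpleDeadZones_bumpSum (hd : AreSeparated ρ d) (hρ : 0 < ρ)
    (hρ' : ρ < π / 2) (hdπ : ∀ i, |d i| ≤ π) : HasSimpleDeadZones (bumpSum ρ w d) := by
  refine ⟨?_, hd.locallyConstantSet_bumpSum hρ hρ'⟩
  rw [hd.deadZoneSet_bumpSum hρ hρ']
  -- Cut the circle open to `[-π, π]`. Avoiding one arc leaves two intervals there; `σ` selects one
  -- for each active bump, and an intersection of intervals is preconnected.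
  let Q : (ι → Bool) → Set ℝ := fun σ => Set.Icc (-π) π ∩ ⋂ i, ⋂ _ : w i ≠ 0,
    if σ i then Set.Ioo (d i + ρ) (d i + (2 * π - ρ)) else Set.Ioo (d i - (2 * π - ρ)) (d i - ρ)
  have hkey : ∀ t ∈ Set.Icc (-π) π, ∀ i, cos (t - d i) < cos ρ ↔
      (t ∈ Set.Ioo (d i + ρ) (d i + (2 * π - ρ)) ∨ t ∈ Set.Ioo (d i - (2 * π - ρ)) (d i - ρ)) := by
    intro t ht i
    have h1 := abs_le.1 (hdπ i)
    rw [cos_lt_cos_iff_of_abs_le_two_pi hρ.le (by linarith [Real.pi_pos])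
      (abs_le.2 ⟨by linarith [ht.1], by linarith [ht.2]⟩)]
    simp only [Set.mem_Ioo]
    rcases abs_cases (t - d i) with ⟨h, h'⟩ | ⟨h, h'⟩ <;> rw [h]
    · constructor
      · rintro ⟨ha, hb⟩; left; constructor <;> linarith
      · rintro (⟨ha, hb⟩ | ⟨ha, hb⟩) <;> constructor <;> linarith
    · constructor
      · rintro ⟨ha, hb⟩; right; constructor <;> linarith
      · rintro (⟨ha, hb⟩ | ⟨ha, hb⟩) <;> constructor <;> linarith
  refine finite_connectedComponents_of_eq_iUnion
    (P := fun σ => ((↑) : ℝ → Real.Angle) '' Q σ) ?_ fun σ => ?_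
  · ext x
    simp only [Set.mem_ofPred_eq, Set.mem_iUnion, Set.mem_image]
    constructor
    · intro hx
      have hI : x.toReal ∈ Set.Icc (-π) π := abs_le.1 (Real.Angle.abs_toReal_le_pi x)
      have hx' : ∀ i, w i ≠ 0 → cos (x.toReal - d i) < cos ρ := fun i hw => by
        have := hx i hw
        rwa [← Real.Angle.coe_toReal x, ← Real.Angle.coe_sub, Real.Angle.cos_coe] at this
      classical
      refine ⟨fun i => decide (x.toReal ∈ Set.Ioo (d i + ρ) (d i + (2 * π - ρ))), x.toReal,
        ⟨hI, ?_⟩, Real.Angle.coe_toReal x⟩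
      simp only [Set.mem_iInter]
      intro i hw
      by_cases h : x.toReal ∈ Set.Ioo (d i + ρ) (d i + (2 * π - ρ))
      · simp [h]
      · simpa [h] using ((hkey _ hI i).1 (hx' i hw)).resolve_left h
    · rintro ⟨σ, t, ⟨hI, ht⟩, rfl⟩ i hw
      rw [← Real.Angle.coe_sub, Real.Angle.cos_coe, hkey t hI i]
      simp only [Set.mem_iInter] at ht
      have := ht i hw
      split_ifs at this
      exacts [Or.inl this, Or.inr this]
  · refine IsPreconnected.image ?_ _ Real.Angle.continuous_coe.continuousOn
    have : Set.OrdConnected (Q σ) := by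
      refine Set.ordConnected_Icc.inter (Set.ordConnected_iInter fun i =>
        Set.ordConnected_iInter fun _ => ?_)
      split_ifs <;> exact Set.ordConnected_Ioo
    exact this.isPreconnected

theorem AreSeparated.isCouplingFunction_bumpSum (hd : AreSeparated ρ d) (hρ : 0 < ρ)
    (hρ' : ρ < π / 2) {i : ι} (hi : w i ≠ 0) : IsCouplingFunction (bumpSum ρ w d) := by
  refine ⟨contDiff_bumpSum ρ w d, ?_⟩
  rintro ⟨C, hC⟩
  have := hd.cos_sub_le_of_mem_locallyConstantSet (x := (d i : Real.Angle)) hρ hρ'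
    ⟨C, Set.univ, isOpen_univ, Set.mem_univ _, fun y _ => hC y⟩ hi
  rw [sub_self, Real.Angle.cos_zero, ← Real.cos_zero] at this
  exact absurd (cos_lt_cos_of_abs_lt (u := 0) (ρ := ρ) (by linarith [Real.pi_pos]) (by simpa))
    this.not_gt

end Superposition

/-! ### Parents and depths in a diverging tree -/

/-- A diverging tree is given by its root, a parent function and a depth function. -/
theorem IsDivergingTree.exists_parent_depth {N : ℕ} {T : Digraph (Fin N)} (hT : IsDivergingTree T) :
    ∃ (r : Fin N) (p : Fin N → Fin N) (depth : Fin N → ℕ), p r = r ∧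
      (∀ j k, T.Adj j k ↔ k ≠ r ∧ j = p k) ∧ ∀ k, k ≠ r → depth k = depth (p k) + 1 := by
  classical
  obtain ⟨hconn, r, hroot, hpar⟩ := hT
  choose! q hq hq' using hpar
  have hadj : ∀ j k, T.Adj j k ↔ k ≠ r ∧ j = q k := by
    intro j k
    constructor
    · intro h
      have hk : k ≠ r := by
        rintro rfl
        exact hroot j h
      exact ⟨hk, hq' k hk j h⟩
    · rintro ⟨hk, rfl⟩
      exact hq k hk
  -- The root is its own parent, so its term in the tree energy is zero.
  set p : Fin N → Fin N := fun k => if k = r then r else q k with hp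
  have hpr : p r = r := if_pos rfl
  have hpq : ∀ k, k ≠ r → p k = q k := fun k hk => if_neg hk
  have hadj' : ∀ j k, T.Adj j k ↔ k ≠ r ∧ j = p k := by
    intro j k
    rw [hadj]
    exact and_congr_right fun hk => by rw [hpq k hk]
  have hiter : ∀ n, p^[n] r = r := fun n => Function.iterate_fixed hpr n
  -- Reaching the root by iterating `p` is invariant along edges in both directions, hence along
  -- undirected walks; connectedness then gives it for all vertices.
  have hstep : ∀ j k, T.Adj j k → ((∃ n, p^[n] j = r) ↔ ∃ n, p^[n] k = r) := by
    intro j k hjk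
    obtain ⟨hk, rfl⟩ := (hadj' j k).1 hjk
    constructor
    · rintro ⟨n, hn⟩
      exact ⟨n + 1, by rwa [Function.iterate_succ_apply]⟩
    · rintro ⟨n, hn⟩
      cases n with
      | zero => exact absurd hn hk
      | succ n => exact ⟨n, by rwa [Function.iterate_succ_apply] at hn⟩
  have hwalk : ∀ j k, T.toSimpleGraphInclusive.Walk j k →
      ((∃ n, p^[n] j = r) ↔ ∃ n, p^[n] k = r) := by
    intro j k W
    induction W with
    | nil => rfl
    | cons h _ ih =>
      rw [← ih]
      rcases ((SimpleGraph.fromRel_adj _ _ _).1 h).2 with h | h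
      · exact hstep _ _ h
      · exact (hstep _ _ h).symm
  have hreach : ∀ k, ∃ n, p^[n] k = r := by
    intro k
    obtain ⟨W⟩ := hconn.preconnected k r
    exact (hwalk k r W).2 ⟨0, rfl⟩
  refine ⟨r, p, fun k => Nat.find (hreach k), hpr, hadj', fun k hk => ?_⟩
  show Nat.find (hreach k) = Nat.find (hreach (p k)) + 1
  rw [Nat.find_eq_iff]
  constructor
  · rw [Function.iterate_succ_apply]
    exact Nat.find_spec (hreach (p k))
  · intro n hn hn'
    cases n with
    | zero => exact hk hn'
    | succ n =>
      rw [Function.iterate_succ_apply] at hn'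
      exact Nat.find_min (hreach (p k)) (by omega) hn'

/-! ### The Lyapunov function -/

/-- The weighted sum of squared differences along the edges `(p k, k)` of a tree. -/
def treeEnergy {N : ℕ} (γ : Fin N → ℝ) (p : Fin N → Fin N) (ψ : Fin N → ℝ) : ℝ :=
  ∑ k, γ k * (ψ k - ψ (p k)) ^ 2

/-- The derivative of the tree energy at `ψ` in the direction `v`. -/
def treeEnergyDeriv {N : ℕ} (γ : Fin N → ℝ) (p : Fin N → Fin N) (ψ v : Fin N → ℝ) : ℝ :=
  ∑ k, γ k * (2 * (ψ k - ψ (p k)) * (v k - v (p k)))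

section Energy

variable {N : ℕ} {γ : Fin N → ℝ} {p : Fin N → Fin N}

theorem treeEnergy_nonneg (hγ : ∀ k, 0 < γ k) (ψ : Fin N → ℝ) : 0 ≤ treeEnergy γ p ψ :=
  Finset.sum_nonneg fun k _ => mul_nonneg (hγ k).le (sq_nonneg _)

theorem mul_sq_le_treeEnergy (hγ : ∀ k, 0 < γ k) (ψ : Fin N → ℝ) (k : Fin N) :
    γ k * (ψ k - ψ (p k)) ^ 2 ≤ treeEnergy γ p ψ :=
  Finset.single_le_sum (f := fun k => γ k * (ψ k - ψ (p k)) ^ 2)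
    (fun k _ => mul_nonneg (hγ k).le (sq_nonneg _)) (Finset.mem_univ k)

theorem hasDerivWithinAt_treeEnergy {ψ : ℝ → Fin N → ℝ} {v : Fin N → ℝ} {I : Set ℝ} {t : ℝ}
    (h : ∀ k, HasDerivWithinAt (fun s => ψ s k) (v k) I t) :
    HasDerivWithinAt (fun s => treeEnergy γ p (ψ s)) (treeEnergyDeriv γ p (ψ t) v) I t := by
  refine HasDerivWithinAt.fun_sum fun k _ => ?_
  have := (((h k).sub (h (p k))).pow 2).const_mul (γ k)
  simpa using this

/-- All phase differences are controlled by the energy of a spanning tree. -/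
theorem exists_abs_sub_le_sqrt_treeEnergy (hγ : ∀ k, 0 < γ k) {r : Fin N} {depth : Fin N → ℕ}
    (hdepth : ∀ k, k ≠ r → depth k = depth (p k) + 1) :
    ∃ C : ℝ, 0 < C ∧ ∀ (ψ : Fin N → ℝ) (i j : Fin N), |ψ i - ψ j| ≤ C * √(treeEnergy γ p ψ) := by
  have : Nonempty (Fin N) := ⟨r⟩
  obtain ⟨k₀, hk₀⟩ := Finite.exists_min γ
  obtain ⟨k₁, hk₁⟩ := Finite.exists_max depth
  have hs : 0 < √(γ k₀) := Real.sqrt_pos.2 (hγ k₀)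
  -- Each tree edge contributes at most `√V / √(min γ)`, and two vertices are joined through the
  -- root by two paths of at most maximal depth.
  refine ⟨2 * (depth k₁ + 1) / √(γ k₀), by positivity, fun ψ i j => ?_⟩
  set M := √(treeEnergy γ p ψ) / √(γ k₀) with hM
  have hM0 : 0 ≤ M := by positivity
  have he : ∀ k, |ψ k - ψ (p k)| ≤ M := by
    intro k
    rw [hM, ← Real.sqrt_div' _ (hγ k₀).le]
    refine Real.abs_le_sqrt ?_
    rw [le_div_iff₀ (hγ k₀)]
    refine le_trans ?_ (mul_sq_le_treeEnergy hγ ψ k)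
    rw [mul_comm]
    exact mul_le_mul_of_nonneg_right (hk₀ k) (sq_nonneg _)
  have hpath : ∀ n k, depth k = n → |ψ k - ψ r| ≤ n * M := by
    intro n
    induction n with
    | zero =>
      intro k hk
      have : k = r := by
        by_contra hkr
        have := hdepth k hkr
        omega
      simp [this]
    | succ n ih =>
      intro k hk
      by_cases hkr : k = r
      · rw [hkr, sub_self, abs_zero]; positivity
      · have h1 := ih (p k) (by have := hdepth k hkr; omega)
        have h2 := abs_sub_le (ψ k) (ψ (p k)) (ψ r)
        push_cast
        linarith [he k]
  have hroot : ∀ k, |ψ k - ψ r| ≤ (depth k₁ + 1) * M := fun k => by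
    refine (hpath _ k rfl).trans ?_
    have : (depth k : ℝ) ≤ depth k₁ := by exact_mod_cast hk₁ k
    gcongr
    linarith
  calc |ψ i - ψ j| ≤ |ψ i - ψ r| + |ψ r - ψ j| := abs_sub_le _ _ _
    _ ≤ (depth k₁ + 1) * M + (depth k₁ + 1) * M := by
        rw [abs_sub_comm (ψ r)]
        exact add_le_add (hroot i) (hroot j)
    _ = _ := by rw [hM]; ring

/-- Dissipation of the tree energy: the coupling `q` along the tree is nearly linear, the remaining
coupling `R` is small, and the weights decay sufficiently fast along the tree. -/
theorem treeEnergyDeriv_le (hN : 0 < N) (hγ : ∀ k, 0 < γ k) (hγ1 : ∀ k, γ k ≤ 1) {r : Fin N}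
    (hpr : p r = r) {a C ε ω : ℝ} (ha : 0 < a)
    (hγp : ∀ k, k ≠ r → γ k ≤ a ^ 2 / (4 * N) * γ (p k))
    (hC : ∀ (ψ : Fin N → ℝ) (i j : Fin N), |ψ i - ψ j| ≤ C * √(treeEnergy γ p ψ))
    (hε : 0 ≤ ε) (hε' : ε * (8 * N ^ 2 * C ^ 2) ≤ a) {ψ q R : Fin N → ℝ}
    (hq : ∀ k, a * (ψ k - ψ (p k)) ^ 2 ≤ (ψ k - ψ (p k)) * q k)
    (hq' : ∀ k, |q k| ≤ |ψ k - ψ (p k)|) (hR : ∀ k, |R k| ≤ ε * ∑ j, |ψ j - ψ k|) :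
    treeEnergyDeriv γ p ψ (fun k => ω - q k + R k) ≤ -(a / 2) * treeEnergy γ p ψ := by
  have hN' : (0 : ℝ) < N := by exact_mod_cast hN
  set V := treeEnergy γ p ψ with hV
  have hV0 : 0 ≤ V := treeEnergy_nonneg hγ ψ
  set S := C * √V with hS
  have hSS : S ^ 2 = C ^ 2 * V := by rw [hS, mul_pow, Real.sq_sqrt hV0]
  have hS0 : 0 ≤ S := (abs_nonneg _).trans (hC ψ r r)
  have hR' : ∀ k, |R k| ≤ ε * (N * S) := fun k => by
    refine (hR k).trans (mul_le_mul_of_nonneg_left ?_ hε)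
    calc ∑ j, |ψ j - ψ k| ≤ ∑ _j : Fin N, S := Finset.sum_le_sum fun j _ => hC ψ j k
      _ = N * S := by simp
  -- Budget: the vertex's own coupling gives `-2a`, Young's inequality costs `a / 2`, and the
  -- parent's motion and the remainder each cost `a / (2N)` of the total energy. Summing over `N`
  -- vertices leaves `-a / 2`.
  have hterm : ∀ k, γ k * (2 * (ψ k - ψ (p k)) * ((ω - q k + R k) - (ω - q (p k) + R (p k)))) ≤
      -(3 * a / 2) * (γ k * (ψ k - ψ (p k)) ^ 2) + a / N * V := by
    intro k
    set e := ψ k - ψ (p k) with he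
    set e' := ψ (p k) - ψ (p (p k)) with he'
    have h1 : 2 * e * q (p k) ≤ a / 2 * e ^ 2 + 2 / a * e' ^ 2 := by
      have h2 : 2 * e * q (p k) ≤ 2 * (|e| * |e'|) := by
        have := le_abs_self (e * q (p k))
        rw [abs_mul] at this
        nlinarith [hq' (p k), abs_nonneg e]
      have h3 : 0 ≤ (a / 2 * |e| - |e'|) ^ 2 * (2 / a) := by positivity
      have h4 : (a / 2 * |e| - |e'|) ^ 2 * (2 / a) =
          a / 2 * |e| ^ 2 + 2 / a * |e'| ^ 2 - 2 * (|e| * |e'|) := by field_simp; ring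
      rw [sq_abs, sq_abs] at h4
      linarith
    have h5 : γ k * (2 / a * e' ^ 2) ≤ a / (2 * N) * V := by
      by_cases hk : k = r
      · have : e' = 0 := by rw [he', hk, hpr, hpr, sub_self]
        rw [this]
        have : 0 ≤ a / (2 * N) * V := by positivity
        simpa using this
      · calc γ k * (2 / a * e' ^ 2) ≤ (a ^ 2 / (4 * N) * γ (p k)) * (2 / a * e' ^ 2) := by
              gcongr
              exact hγp k hk
          _ = a / (2 * N) * (γ (p k) * e' ^ 2) := by field_simp; ring
          _ ≤ a / (2 * N) * V := by
              gcongr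
              exact mul_sq_le_treeEnergy hγ ψ (p k)
    have h6 : γ k * (2 * e * (R k - R (p k))) ≤ a / (2 * N) * V := by
      have h7 : |2 * e * (R k - R (p k))| ≤ 2 * S * (2 * (ε * (N * S))) := by
        rw [abs_mul, abs_mul, abs_two]
        have h8 : |R k - R (p k)| ≤ 2 * (ε * (N * S)) :=
          (abs_sub _ _).trans (by linarith [hR' k, hR' (p k)])
        gcongr
        exact hC ψ k (p k)
      have h9 : 2 * S * (2 * (ε * (N * S))) ≤ a / (2 * N) * V := by
        rw [div_mul_eq_mul_div, le_div_iff₀ (by positivity)]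
        calc 2 * S * (2 * (ε * (N * S))) * (2 * N) = ε * (8 * N ^ 2) * S ^ 2 := by ring
          _ = ε * (8 * N ^ 2 * C ^ 2) * V := by rw [hSS]; ring
          _ ≤ a * V := by gcongr
      calc γ k * (2 * e * (R k - R (p k))) ≤ γ k * |2 * e * (R k - R (p k))| :=
            mul_le_mul_of_nonneg_left (le_abs_self _) (hγ k).le
        _ ≤ 1 * |2 * e * (R k - R (p k))| :=
            mul_le_mul_of_nonneg_right (hγ1 k) (abs_nonneg _)
        _ ≤ _ := by linarith
    have h10 : γ k * (2 * e * ((ω - q k + R k) - (ω - q (p k) + R (p k)))) =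
        -2 * (γ k * (e * q k)) + γ k * (2 * e * q (p k)) + γ k * (2 * e * (R k - R (p k))) := by
      ring
    have h11 := mul_le_mul_of_nonneg_left (hq k) (hγ k).le
    have h12 := mul_le_mul_of_nonneg_left h1 (hγ k).le
    have h13 : a / N * V = a / (2 * N) * V + a / (2 * N) * V := by field_simp; ring
    rw [h10, h13]
    nlinarith
  calc treeEnergyDeriv γ p ψ (fun k => ω - q k + R k)
      ≤ ∑ k, (-(3 * a / 2) * (γ k * (ψ k - ψ (p k)) ^ 2) + a / N * V) :=
        Finset.sum_le_sum fun k _ => hterm k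
    _ = -(3 * a / 2) * V + a * V := by
        rw [Finset.sum_add_distrib, ← Finset.mul_sum, hV, treeEnergy]
        simp only [Finset.sum_const, Finset.card_univ, Fintype.card_fin, nsmul_eq_mul]
        field_simp
    _ = _ := by ring

end Energy

/-! ### Stability from a Lyapunov function -/

/-- A function that decays at rate `κ` whenever it is below a threshold `v₀` stays below `v₀` and
decays exponentially. -/
theorem le_mul_exp_of_deriv_le {f f' : ℝ → ℝ} {v₀ κ b : ℝ} (hκ : 0 < κ) (hb : 0 < b) (hb' : b < v₀)
    (hf : ∀ t, 0 ≤ t → HasDerivWithinAt f (f' t) (Set.Ici 0) t)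
    (hle : ∀ t, 0 ≤ t → f t < v₀ → f' t ≤ -κ * f t) (h0 : f 0 ≤ b) {t : ℝ} (ht : 0 ≤ t) :
    f t ≤ b * exp (-(κ / 2) * t) := by
  have hB : ∀ x, HasDerivAt (fun x => b * exp (-(κ / 2) * x))
      (b * (exp (-(κ / 2) * x) * (-(κ / 2)))) x := fun x => by
    have := ((hasDerivAt_id x).const_mul (-(κ / 2))).exp.const_mul b
    simpa using this
  -- The barrier decays at half the rate, which makes the derivative comparison strict at a contact
  -- point; it starts below `v₀`, so the decay hypothesis applies there.
  refine image_le_of_deriv_right_lt_deriv_boundary' (a := 0) (b := t) (f := f) (f' := f')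
    (fun x hx => ((hf x hx.1).continuousWithinAt).mono Set.Icc_subset_Ici_self)
    (fun x hx => (hf x hx.1).mono (Set.Ici_subset_Ici.2 hx.1))
    (B := fun x => b * exp (-(κ / 2) * x)) (by simpa using h0)
    (fun x _ => (hB x).continuousAt.continuousWithinAt) (fun x _ => (hB x).hasDerivWithinAt)
    (fun x hx hfx => ?_) ⟨ht, le_rfl⟩
  have hexp : exp (-(κ / 2) * x) ≤ 1 := Real.exp_le_one_iff.2 (by nlinarith [hx.1])
  have hpos : 0 < b * exp (-(κ / 2) * x) := by positivity
  have hlt : f x < v₀ := by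
    rw [hfx]
    nlinarith
  have := hle x hx.1 hlt
  rw [hfx] at this
  nlinarith

theorem Angle.dist_coe_le (x y : ℝ) : dist (x : Real.Angle) (y : Real.Angle) ≤ |x - y| := by
  rw [dist_eq_norm, ← Real.Angle.coe_sub, ← Real.norm_eq_abs]
  exact QuotientAddGroup.norm_mk_le_norm

theorem Angle.exists_coe_eq_sub_of_dist_lt {x y : Real.Angle} {δ : ℝ} (h : dist x y < δ) :
    ∃ u : ℝ, (u : Real.Angle) = x - y ∧ |u| < δ := by
  rw [dist_eq_norm] at h
  exact QuotientAddGroup.norm_lt_iff.1 h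

section Lyapunov

variable {N : ℕ} {ω : ℝ} {g : Real.Angle → ℝ} {θo γ : Fin N → ℝ} {p : Fin N → Fin N}

/-- The state with phase `θo k + ψ k` at the vertex `k`. -/
noncomputable def torusPoint (θo ψ : Fin N → ℝ) (k : Fin N) : Real.Angle :=
  ((θo k + ψ k : ℝ) : Real.Angle)

/-- The states whose deviation from `θo` has tree energy less than `b`. -/
def energySublevel (θo γ : Fin N → ℝ) (p : Fin N → Fin N) (b : ℝ) : Set (Fin N → Real.Angle) :=
  torusPoint θo '' {ψ | treeEnergy γ p ψ < b}

/-- The tree energy of deviations from `θo` decays at rate `κ` along solutions, as long as it is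
less than `v₀`. -/
def IsDissipative (ω : ℝ) (g : Real.Angle → ℝ) (θo γ : Fin N → ℝ) (p : Fin N → Fin N)
    (v₀ κ : ℝ) : Prop :=
  ∀ ψ : Fin N → ℝ, treeEnergy γ p ψ < v₀ →
    treeEnergyDeriv γ p ψ (networkField ω g (torusPoint θo ψ)) ≤ -κ * treeEnergy γ p ψ

/-- The projection from the line to the circle is open, so openness passes from deviations to
states. -/
theorem isOpen_energySublevel (b : ℝ) : IsOpen (energySublevel θo γ p b) := by
  have hopen : IsOpenMap (torusPoint θo) := by
    have h1 : IsOpenMap (Pi.map fun (_ : Fin N) (x : ℝ) => (x : Real.Angle)) :=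
      IsOpenMap.piMap (fun _ => QuotientAddGroup.isOpenMap_coe) (by simp)
    exact h1.comp (Homeomorph.addLeft θo).isOpenMap
  refine hopen _ (isOpen_lt ?_ continuous_const)
  unfold treeEnergy
  fun_prop

theorem IsDissipative.exists_decay {v₀ κ b : ℝ} (hd : IsDissipative ω g θo γ p v₀ κ) (hκ : 0 < κ)
    (hγ : ∀ k, 0 < γ k) (hb : b ≤ v₀) {θ : ℝ → Fin N → Real.Angle}
    (hθ : IsSolutionOn ω g (Set.Ici 0) θ) (h0 : θ 0 ∈ energySublevel θo γ p b) {t : ℝ}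
    (ht : 0 ≤ t) :
    ∃ ψ, torusPoint θo ψ = θ t ∧ treeEnergy γ p ψ < b * exp (-(κ / 2) * t) := by
  obtain ⟨φ, hφ⟩ := hθ
  obtain ⟨ψ₀, hψ₀, hψ₀θ⟩ := h0
  -- The given lift need not start at `θo + ψ₀`; it is shifted by a constant that is trivial on the
  -- circle.
  set ψ : ℝ → Fin N → ℝ := fun t k => φ t k - φ 0 k + ψ₀ k with hψ
  have hψθ : ∀ t, 0 ≤ t → torusPoint θo (ψ t) = θ t := by
    intro t ht
    funext k
    have h1 : ((θo k + ψ₀ k : ℝ) : Real.Angle) = (φ 0 k : Real.Angle) := by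
      rw [← (hφ 0 (Set.mem_Ici.2 le_rfl) k).1, ← hψ₀θ, torusPoint]
    have h2 : θo k + ψ t k = φ t k + ((θo k + ψ₀ k) - φ 0 k) := by simp only [hψ]; ring
    rw [torusPoint, h2, Real.Angle.coe_add, Real.Angle.coe_sub, h1, sub_self, add_zero,
      (hφ t ht k).1]
  have hψ0 : ψ 0 = ψ₀ := by funext k; simp [hψ]
  have hder : ∀ t, 0 ≤ t → HasDerivWithinAt (fun s => treeEnergy γ p (ψ s))
      (treeEnergyDeriv γ p (ψ t) (networkField ω g (θ t))) (Set.Ici 0) t := fun t ht =>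
    hasDerivWithinAt_treeEnergy fun k => ((hφ t ht k).2.sub_const _).add_const _
  have hE0 : treeEnergy γ p ψ₀ < b := hψ₀
  have hE := treeEnergy_nonneg (p := p) hγ ψ₀
  -- The midpoint between the initial energy and `b` is positive and strictly below both `b` and
  -- `v₀`.
  have hdec := le_mul_exp_of_deriv_le (b := (treeEnergy γ p ψ₀ + b) / 2) (v₀ := v₀) hκ
    (by linarith) (by linarith) hder
    (fun t ht hlt => by rw [← hψθ t ht]; exact hd (ψ t) hlt)
    (by rw [hψ0]; linarith) ht
  refine ⟨ψ t, hψθ t ht, hdec.trans_lt ?_⟩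
  have := Real.exp_pos (-(κ / 2) * t)
  nlinarith

theorem IsDissipative.isForwardInvariant {v₀ κ b : ℝ} (hd : IsDissipative ω g θo γ p v₀ κ)
    (hκ : 0 < κ) (hγ : ∀ k, 0 < γ k) (hb : b ≤ v₀) :
    IsForwardInvariant ω g (energySublevel θo γ p b) := by
  intro θ hθ h0 t ht
  obtain ⟨ψ, hψ, hlt⟩ := hd.exists_decay hκ hγ hb hθ h0 ht
  refine ⟨ψ, ?_, hψ⟩
  have h1 : exp (-(κ / 2) * t) ≤ 1 := Real.exp_le_one_iff.2 (by nlinarith)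
  have h2 := Real.exp_pos (-(κ / 2) * t)
  have h3 := treeEnergy_nonneg (p := p) hγ ψ
  have h4 : 0 < b := by
    by_contra! hb0
    nlinarith
  show treeEnergy γ p ψ < b
  nlinarith

/-- Contracting the deviation towards the phase of the vertex `r` scales the energy. -/
theorem exists_contraction (r : Fin N) {C : ℝ}
    (hC : ∀ (ψ : Fin N → ℝ) (i j : Fin N), |ψ i - ψ j| ≤ C * √(treeEnergy γ p ψ))
    (ψ : Fin N → ℝ) {s : ℝ} (hs : s ≤ 1) :
    treeEnergy γ p (fun k => ψ r + s * (ψ k - ψ r)) = s ^ 2 * treeEnergy γ p ψ ∧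
    dist (torusPoint θo ψ) (torusPoint θo fun k => ψ r + s * (ψ k - ψ r)) ≤
      (1 - s) * (C * √(treeEnergy γ p ψ)) := by
  constructor
  · unfold treeEnergy
    rw [Finset.mul_sum]
    exact Finset.sum_congr rfl fun k _ => by ring
  · have h0 : 0 ≤ C * √(treeEnergy γ p ψ) := (abs_nonneg _).trans (hC ψ r r)
    refine (dist_pi_le_iff (mul_nonneg (by linarith) h0)).2 fun k => ?_
    refine (Angle.dist_coe_le _ _).trans ?_
    have : θo k + ψ k - (θo k + (ψ r + s * (ψ k - ψ r))) = (1 - s) * (ψ k - ψ r) := by ring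
    rw [this, abs_mul, abs_of_nonneg (by linarith : 0 ≤ 1 - s)]
    exact mul_le_mul_of_nonneg_left (hC ψ k r) (by linarith)

theorem torusPoint_const_mem_phaseShiftOrbit (c : ℝ) :
    torusPoint θo (fun _ => c) ∈ phaseShiftOrbit fun k => (θo k : Real.Angle) :=
  ⟨(c : Real.Angle), by funext k; simp [torusPoint]⟩

theorem exists_eq_torusPoint_of_mem_phaseShiftOrbit {θ : Fin N → Real.Angle}
    (h : θ ∈ phaseShiftOrbit fun k => (θo k : Real.Angle)) :
    ∃ ψ, torusPoint θo ψ = θ ∧ treeEnergy γ p ψ = 0 := by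
  obtain ⟨c, rfl⟩ := h
  induction c using Real.Angle.induction_on with
  | _ c => exact ⟨fun _ => c, by funext k; simp [torusPoint], by simp [treeEnergy]⟩

theorem phaseShiftOrbit_subset_energySublevel {b : ℝ} (hb : 0 < b) :
    (phaseShiftOrbit fun k => (θo k : Real.Angle)) ⊆ energySublevel θo γ p b := by
  intro θ hθ
  obtain ⟨ψ, hψ, h0⟩ := exists_eq_torusPoint_of_mem_phaseShiftOrbit (γ := γ) (p := p) hθ
  refine ⟨ψ, ?_, hψ⟩
  show treeEnergy γ p ψ < b
  rwa [h0]

theorem infDist_phaseShiftOrbit_le (r : Fin N) {C : ℝ}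
    (hC : ∀ (ψ : Fin N → ℝ) (i j : Fin N), |ψ i - ψ j| ≤ C * √(treeEnergy γ p ψ))
    (ψ : Fin N → ℝ) :
    Metric.infDist (torusPoint θo ψ) (phaseShiftOrbit fun k => (θo k : Real.Angle)) ≤
      C * √(treeEnergy γ p ψ) := by
  have h := (exists_contraction (θo := θo) r hC ψ (s := 0) zero_le_one).2
  simp only [zero_mul, add_zero, sub_zero, one_mul] at h
  exact (Metric.infDist_le_dist_of_mem (torusPoint_const_mem_phaseShiftOrbit (ψ r))).trans h

/-- Points close to a state of energy at most `b₀` have energy less than `b₁`, uniformly. -/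
theorem exists_pos_forall_dist_lt_mem_energySublevel (hγ : ∀ k, 0 < γ k) (hγ1 : ∀ k, γ k ≤ 1)
    {C : ℝ} (hC0 : 0 ≤ C)
    (hC : ∀ (ψ : Fin N → ℝ) (i j : Fin N), |ψ i - ψ j| ≤ C * √(treeEnergy γ p ψ))
    {b₀ b₁ : ℝ} (hb : b₀ < b₁) :
    ∃ δ : ℝ, 0 < δ ∧ ∀ (θ : Fin N → Real.Angle) (ψ : Fin N → ℝ), treeEnergy γ p ψ ≤ b₀ →
      dist θ (torusPoint θo ψ) < δ → θ ∈ energySublevel θo γ p b₁ := by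
  set E := C * √b₀ with hE
  have hE0 : 0 ≤ E := by positivity
  -- For `δ ≤ 1`, each squared edge difference grows by at most `4Eδ + 4δ²`, hence by at most `δ *
  -- (4 * E + 4)`.
  set L := (N : ℝ) * (4 * E + 4) + 1 with hL
  have hL0 : 0 < L := by positivity
  refine ⟨min 1 ((b₁ - b₀) / L), lt_min one_pos (div_pos (sub_pos.2 hb) hL0),
    fun θ ψ hψ hdist => ?_⟩
  set δ := min 1 ((b₁ - b₀) / L) with hδ
  have hδ0 : 0 < δ := lt_min one_pos (div_pos (sub_pos.2 hb) hL0)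
  have hδ1 : δ ≤ 1 := min_le_left _ _
  have hδL : δ * L ≤ b₁ - b₀ := (le_div_iff₀ hL0).1 (min_le_right _ _)
  have hex : ∀ k, ∃ u : ℝ, (u : Real.Angle) = θ k - torusPoint θo ψ k ∧ |u| < δ := fun k =>
    Angle.exists_coe_eq_sub_of_dist_lt ((dist_le_pi_dist _ _ k).trans_lt hdist)
  choose u hu huδ using hex
  refine ⟨fun k => ψ k + u k, ?_, ?_⟩
  · show treeEnergy γ p _ < b₁
    have hterm : ∀ k, γ k * (ψ k + u k - (ψ (p k) + u (p k))) ^ 2 ≤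
        γ k * (ψ k - ψ (p k)) ^ 2 + δ * (4 * E + 4) := by
      intro k
      have h1 : |ψ k - ψ (p k)| ≤ E := (hC ψ k (p k)).trans (by rw [hE]; gcongr)
      have h2 : |u k - u (p k)| ≤ 2 * δ :=
        (abs_sub _ _).trans (by linarith [huδ k, huδ (p k)])
      set e := ψ k - ψ (p k) with he
      set y := u k - u (p k) with hy
      have h3 : ψ k + u k - (ψ (p k) + u (p k)) = e + y := by rw [he, hy]; ring
      have h4 : e * y ≤ E * (2 * δ) := by
        have := le_abs_self (e * y)
        rw [abs_mul] at this
        exact this.trans (mul_le_mul h1 h2 (abs_nonneg _) hE0)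
      have h5 : y ^ 2 ≤ (2 * δ) ^ 2 := by
        rw [← sq_abs y]
        gcongr
      have h6 : 2 * (e * y) + y ^ 2 ≤ δ * (4 * E + 4) := by nlinarith
      have h7 : 0 ≤ δ * (4 * E + 4) := by positivity
      rw [h3, show γ k * (e + y) ^ 2 = γ k * e ^ 2 + γ k * (2 * (e * y) + y ^ 2) by ring]
      have h8 := mul_le_mul_of_nonneg_left h6 (hγ k).le
      have h9 := mul_le_mul_of_nonneg_right (hγ1 k) h7
      linarith
    have hsum : treeEnergy γ p (fun k => ψ k + u k) ≤
        treeEnergy γ p ψ + N * (δ * (4 * E + 4)) := by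
      refine (Finset.sum_le_sum fun k _ => hterm k).trans_eq ?_
      rw [Finset.sum_add_distrib]
      simp [treeEnergy]
    rw [hL] at hδL
    nlinarith
  · funext k
    rw [torusPoint, ← add_assoc, Real.Angle.coe_add, hu k, torusPoint, add_sub_cancel]

theorem IsDissipative.tendsto_infDist_phaseShiftOrbit {v₀ κ C : ℝ}
    (hd : IsDissipative ω g θo γ p v₀ κ) (hκ : 0 < κ) (hγ : ∀ k, 0 < γ k) (r : Fin N)
    (hC0 : 0 ≤ C)
    (hC : ∀ (ψ : Fin N → ℝ) (i j : Fin N), |ψ i - ψ j| ≤ C * √(treeEnergy γ p ψ))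
    {θ : ℝ → Fin N → Real.Angle} (hθ : IsSolutionOn ω g (Set.Ici 0) θ)
    (h0 : θ 0 ∈ energySublevel θo γ p v₀) :
    Tendsto (fun t => Metric.infDist (θ t) (phaseShiftOrbit fun k => (θo k : Real.Angle)))
      atTop (𝓝 0) := by
  have hlim : Tendsto (fun t : ℝ => C * √(v₀ * exp (-(κ / 2) * t))) atTop (𝓝 0) := by
    have h1 : Tendsto (fun t : ℝ => -(κ / 2) * t) atTop atBot :=
      (tendsto_const_mul_atBot_of_neg (by linarith)).2 tendsto_id
    have h2 := ((Real.tendsto_exp_atBot.comp h1).const_mul v₀).sqrt.const_mul C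
    simpa using h2
  refine squeeze_zero' (Eventually.of_forall fun t => Metric.infDist_nonneg) ?_ hlim
  filter_upwards [eventually_ge_atTop 0] with t ht
  obtain ⟨ψ, hψ, hlt⟩ := hd.exists_decay hκ hγ le_rfl hθ h0 ht
  rw [← hψ]
  refine (infDist_phaseShiftOrbit_le r hC ψ).trans ?_
  gcongr

theorem IsDissipative.isAsymptoticallyStable_phaseShiftOrbit {v₀ κ C : ℝ}
    (hd : IsDissipative ω g θo γ p v₀ κ) (hv₀ : 0 < v₀) (hκ : 0 < κ) (hγ : ∀ k, 0 < γ k)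
    (hγ1 : ∀ k, γ k ≤ 1) (r : Fin N) (hC0 : 0 < C)
    (hC : ∀ (ψ : Fin N → ℝ) (i j : Fin N), |ψ i - ψ j| ≤ C * √(treeEnergy γ p ψ)) :
    IsAsymptoticallyStable ω g (phaseShiftOrbit fun k => (θo k : Real.Angle)) := by
  have hthick : ∀ b, 0 < b → ∃ δ : ℝ, 0 < δ ∧ ∀ θ ∈ Metric.thickening δ
      (phaseShiftOrbit fun k => (θo k : Real.Angle)), θ ∈ energySublevel θo γ p b := by
    intro b hb
    obtain ⟨δ, hδ, h⟩ := exists_pos_forall_dist_lt_mem_energySublevel (θo := θo) hγ hγ1 hC0.le hC hb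
    refine ⟨δ, hδ, fun θ hθ => ?_⟩
    obtain ⟨θ', hθ', hdist⟩ := Metric.mem_thickening_iff.1 hθ
    obtain ⟨ψ, rfl, hψ⟩ := exists_eq_torusPoint_of_mem_phaseShiftOrbit (γ := γ) (p := p) hθ'
    exact h θ ψ hψ.le hdist
  constructor
  · intro ε hε
    obtain ⟨δ, hδ, h⟩ := hthick (min v₀ ((ε / C) ^ 2)) (lt_min hv₀ (by positivity))
    refine ⟨δ, hδ, fun θ hθ h0 t ht => ?_⟩
    obtain ⟨ψ, hψ, hψθ⟩ :=
      hd.isForwardInvariant hκ hγ (min_le_left _ _) θ hθ (h _ h0) t ht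
    rw [Metric.mem_thickening_iff, ← hψθ, ← Metric.infDist_lt_iff]
    · refine (infDist_phaseShiftOrbit_le r hC ψ).trans_lt ?_
      have h1 : √(treeEnergy γ p ψ) < ε / C :=
        (Real.sqrt_lt' (by positivity)).2 (lt_of_lt_of_le hψ (min_le_right _ _))
      rw [mul_comm]
      exact (lt_div_iff₀ hC0).1 h1
    · exact ⟨_, torusPoint_const_mem_phaseShiftOrbit 0⟩
  · obtain ⟨δ, hδ, h⟩ := hthick v₀ hv₀
    exact ⟨δ, hδ, fun θ hθ h0 =>
      hd.tendsto_infDist_phaseShiftOrbit hκ hγ r hC0.le hC hθ (h _ h0)⟩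

/-- Attraction is inherited from the phase-shift orbit inside the sublevel. For Lyapunov stability,
a state of energy slightly above `b` is contracted a short way into the sublevel. -/
theorem IsDissipative.isAsymptoticallyStable_energySublevel {v₀ κ C b : ℝ}
    (hd : IsDissipative ω g θo γ p v₀ κ) (hb : 0 < b) (hbv : b < v₀) (hκ : 0 < κ)
    (hγ : ∀ k, 0 < γ k) (hγ1 : ∀ k, γ k ≤ 1) (r : Fin N) (hC0 : 0 < C)
    (hC : ∀ (ψ : Fin N → ℝ) (i j : Fin N), |ψ i - ψ j| ≤ C * √(treeEnergy γ p ψ)) :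
    IsAsymptoticallyStable ω g (energySublevel θo γ p b) := by
  have hthick : ∀ b₁, b < b₁ → ∃ δ : ℝ, 0 < δ ∧ ∀ θ ∈ Metric.thickening δ
      (energySublevel θo γ p b), θ ∈ energySublevel θo γ p b₁ := by
    intro b₁ hb₁
    obtain ⟨δ, hδ, h⟩ :=
      exists_pos_forall_dist_lt_mem_energySublevel (θo := θo) hγ hγ1 hC0.le hC hb₁
    refine ⟨δ, hδ, fun θ hθ => ?_⟩
    obtain ⟨_, ⟨ψ, hψ, rfl⟩, hdist⟩ := Metric.mem_thickening_iff.1 hθ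
    exact h θ ψ (le_of_lt hψ) hdist
  constructor
  · intro ε hε
    set D := C * √v₀ with hD
    have hD0 : 0 ≤ D := by positivity
    -- Contraction by `1 - τ` moves a state by at most `τ * D < ε` and brings energies below `b / (1
    -- - τ) ^ 2` under `b`.
    set τ := min (1 / 2) (ε / (D + 1)) with hτ
    have hτ0 : 0 < τ := lt_min (by norm_num) (by positivity)
    have hτ1 : τ ≤ 1 / 2 := min_le_left _ _
    have hτD : τ * (D + 1) ≤ ε := (le_div_iff₀ (by linarith)).1 (min_le_right _ _)
    have hs2 : 0 < (1 - τ) ^ 2 := pow_pos (by linarith) 2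
    have hs1 : (1 - τ) ^ 2 < 1 := by nlinarith
    set b₁ := min v₀ (b / (1 - τ) ^ 2) with hb₁
    obtain ⟨δ, hδ, h⟩ := hthick b₁ (lt_min hbv (by rw [lt_div_iff₀ hs2]; nlinarith))
    refine ⟨δ, hδ, fun θ hθ h0 t ht => ?_⟩
    obtain ⟨ψ, hψ, hψθ⟩ :=
      hd.isForwardInvariant hκ hγ (min_le_left _ _) θ hθ (h _ h0) t ht
    have hψ1 : treeEnergy γ p ψ < v₀ := lt_of_lt_of_le hψ (min_le_left _ _)
    have hψ2 : treeEnergy γ p ψ * (1 - τ) ^ 2 < b :=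
      (lt_div_iff₀ hs2).1 (lt_of_lt_of_le hψ (min_le_right _ _))
    obtain ⟨hE, hdist⟩ := exists_contraction (θo := θo) r hC ψ (s := 1 - τ) (by linarith)
    refine Metric.mem_thickening_iff.2 ⟨_, ⟨fun k => ψ r + (1 - τ) * (ψ k - ψ r), ?_, rfl⟩, ?_⟩
    · show treeEnergy γ p _ < b
      rw [hE]
      linarith
    · rw [← hψθ]
      refine hdist.trans_lt ?_
      have : C * √(treeEnergy γ p ψ) ≤ D := by rw [hD]; gcongr
      nlinarith
  · obtain ⟨δ, hδ, h⟩ := hthick v₀ hbv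
    refine ⟨δ, hδ, fun θ hθ h0 => squeeze_zero (fun t => Metric.infDist_nonneg) (fun t => ?_)
      (hd.tendsto_infDist_phaseShiftOrbit hκ hγ r hC0.le hC hθ (h _ h0))⟩
    exact Metric.infDist_le_infDist_of_subset (phaseShiftOrbit_subset_energySublevel hb)
      ⟨_, torusPoint_const_mem_phaseShiftOrbit 0⟩

end Lyapunov

/-! ### Phases with distinct differences -/

/-- The larger exponents must agree: if `j < l`, both powers on the left are at most half of `2 ^
l`. -/
theorem eq_and_eq_of_two_pow_add_eq_of_lt {j k l m : ℕ} (hkj : k < j) (hml : m < l)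
    (h : 2 ^ j + 2 ^ m = 2 ^ l + 2 ^ k) : j = l ∧ k = m := by
  have key : ∀ {j k l m : ℕ}, m < l → 2 ^ j + 2 ^ m = 2 ^ l + 2 ^ k → ¬ j < l := by
    intro j k l m hml h hjl
    have h1 : 2 ^ (j + 1) ≤ 2 ^ l := Nat.pow_le_pow_right (by norm_num) hjl
    have h2 : 2 ^ (m + 1) ≤ 2 ^ l := Nat.pow_le_pow_right (by norm_num) hml
    have h3 : 0 < 2 ^ k := by positivity
    rw [pow_succ] at h1 h2
    omega
  have hjl : j = l := le_antisymm (not_lt.1 (key hkj h.symm)) (not_lt.1 (key hml h))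
  subst hjl
  exact ⟨rfl, (Nat.pow_right_injective le_rfl (Nat.add_left_cancel h)).symm⟩

/-- Differences of distinct powers of two determine the exponents. -/
theorem eq_and_eq_of_two_pow_add_eq {j k l m : ℕ} (hjk : j ≠ k) (hlm : l ≠ m)
    (h : 2 ^ j + 2 ^ m = 2 ^ l + 2 ^ k) : j = l ∧ k = m := by
  rcases lt_or_gt_of_ne hjk with hjk | hjk <;> rcases lt_or_gt_of_ne hlm with hlm | hlm
  · have := eq_and_eq_of_two_pow_add_eq_of_lt hjk hlm (by omega)
    exact ⟨this.2, this.1⟩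
  · have h1 := Nat.pow_lt_pow_right (a := 2) (by norm_num) hjk
    have h2 := Nat.pow_lt_pow_right (a := 2) (by norm_num) hlm
    omega
  · have h1 := Nat.pow_lt_pow_right (a := 2) (by norm_num) hjk
    have h2 := Nat.pow_lt_pow_right (a := 2) (by norm_num) hlm
    omega
  · exact eq_and_eq_of_two_pow_add_eq_of_lt hjk hlm h

/-- The ordered pairs of distinct vertices, and one additional index. -/
abbrev BumpIndex (N : ℕ) : Type := Option {q : Fin N × Fin N // q.1 ≠ q.2}

/-- The phase differences of `θ`, and the additional point `π`. -/
noncomputable def bumpCentre {N : ℕ} (θ : Fin N → ℝ) : BumpIndex N → ℝ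
  | none => π
  | some q => θ q.1.1 - θ q.1.2

theorem cos_le_two_mul_cos_sq_sub_one {D ρ : ℝ} (hρ : 0 ≤ ρ) (h1 : 2 * ρ ≤ |D|)
    (h2 : |D| ≤ 2 * π - 2 * ρ) : cos D ≤ 2 * cos ρ ^ 2 - 1 := by
  rw [← Real.cos_two_mul, ← Real.cos_abs D]
  rcases le_total |D| π with h | h
  · exact Real.cos_le_cos_of_nonneg_of_le_pi (by linarith) h h1
  · rw [← Real.cos_two_pi_sub |D|]
    exact Real.cos_le_cos_of_nonneg_of_le_pi (by linarith) (by linarith) (by linarith)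

theorem exists_areSeparated_bumpCentre (N : ℕ) :
    ∃ (θ : Fin N → ℝ) (ρ : ℝ), 0 < ρ ∧ ρ < π / 2 ∧ AreSeparated ρ (bumpCentre θ) ∧
      (∀ i, |bumpCentre θ i| ≤ π) ∧ ∀ i, cos (bumpCentre θ i) < cos ρ := by
  have hπ := Real.pi_gt_three
  have h2N : (0 : ℝ) < 2 ^ N := by positivity
  have h2N1 : (1 : ℝ) ≤ 2 ^ N := one_le_pow₀ (by norm_num)
  -- Scaled powers of two have distinct differences, all multiples of `1 / 2 ^ N = 2ρ`; distinct
  -- centres are thus at least `2ρ` apart. Scaling into `(0, 1)` prevents wrap-around and keeps the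
  -- differences away from `π`.
  set θ : Fin N → ℝ := fun k => 2 ^ (k : ℕ) / 2 ^ N with hθ
  set ρ : ℝ := 1 / 2 ^ N / 2 with hρ
  have hρ2 : 2 * ρ = 1 / 2 ^ N := by rw [hρ]; ring
  have hρ0 : 0 < ρ := by positivity
  have hρ1 : 2 * ρ ≤ 1 := by rw [hρ2]; exact (div_le_one h2N).2 h2N1
  have hθ0 : ∀ k, 0 < θ k := fun k => by positivity
  have hθ1 : ∀ k, θ k < 1 := fun k =>
    (div_lt_one h2N).2 (pow_lt_pow_right₀ (by norm_num) k.2)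
  have hmultiple : ∀ n : ℤ, n ≠ 0 → 2 * ρ ≤ |(n : ℝ) / 2 ^ N| := fun n hn => by
    rw [hρ2, abs_div, abs_of_pos h2N]
    have : (1 : ℝ) ≤ |(n : ℝ)| := by exact_mod_cast Int.one_le_abs hn
    gcongr
  have hdiff : ∀ j k : Fin N, |θ j - θ k| < 1 := fun j k =>
    abs_lt.2 ⟨by linarith [hθ0 j, hθ1 k], by linarith [hθ0 k, hθ1 j]⟩
  have hsep : ∀ j k : Fin N, j ≠ k → 2 * ρ ≤ |θ j - θ k| := by
    intro j k hjk
    have hn : ((2 : ℤ) ^ (j : ℕ) - 2 ^ (k : ℕ)) ≠ 0 := by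
      intro h0
      have h1 : 2 ^ (j : ℕ) = 2 ^ (k : ℕ) := by exact_mod_cast sub_eq_zero.1 h0
      exact hjk (Fin.ext (Nat.pow_right_injective le_rfl h1))
    have := hmultiple _ hn
    push_cast at this
    rwa [sub_div] at this
  have hπsep : ∀ x : ℝ, |x| < 1 → cos (π - x) ≤ 2 * cos ρ ^ 2 - 1 := fun x hx => by
    have := abs_lt.1 hx
    have h0 : 0 < π - x := by linarith
    exact cos_le_two_mul_cos_sq_sub_one hρ0.le (by rw [abs_of_pos h0]; linarith)
      (by rw [abs_of_pos h0]; linarith)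
  refine ⟨θ, ρ, hρ0, by linarith, ?_, ?_, ?_⟩
  · rintro (_ | ⟨⟨j, k⟩, hjk⟩) (_ | ⟨⟨l, m⟩, hlm⟩) hne
    · exact absurd rfl hne
    · exact hπsep _ (hdiff l m)
    · show cos (θ j - θ k - π) ≤ _
      rw [← Real.cos_neg, neg_sub]
      exact hπsep _ (hdiff j k)
    · show cos (θ j - θ k - (θ l - θ m)) ≤ _
      refine cos_le_two_mul_cos_sq_sub_one hρ0.le ?_ ?_
      · have hn : ((2 : ℤ) ^ (j : ℕ) - 2 ^ (k : ℕ) - (2 ^ (l : ℕ) - 2 ^ (m : ℕ))) ≠ 0 := by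
          intro h0
          have h1 : 2 ^ (j : ℕ) + 2 ^ (m : ℕ) = 2 ^ (l : ℕ) + 2 ^ (k : ℕ) := by
            zify
            linarith
          obtain ⟨h2, h3⟩ := eq_and_eq_of_two_pow_add_eq (fun h => hjk (Fin.ext h))
            (fun h => hlm (Fin.ext h)) h1
          obtain rfl := Fin.ext h2
          obtain rfl := Fin.ext h3
          exact hne rfl
        have := hmultiple _ hn
        push_cast at this
        rwa [sub_div, sub_div, sub_div] at this
      · have := abs_sub (θ j - θ k) (θ l - θ m)
        linarith [hdiff j k, hdiff l m]
  · rintro (_ | ⟨⟨j, k⟩, hjk⟩)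
    · exact (abs_of_pos Real.pi_pos).le
    · exact (hdiff j k).le.trans (by linarith)
  · have hstrict : 2 * cos ρ ^ 2 - 1 < cos ρ := by
      rw [← Real.cos_two_mul]
      exact Real.cos_lt_cos_of_nonneg_of_le_pi hρ0.le (by linarith) (by linarith)
    rintro (_ | ⟨⟨j, k⟩, hjk⟩)
    · exact lt_of_le_of_lt (by simpa [bumpCentre] using hπsep 0 (by simp)) hstrict
    · exact lt_of_le_of_lt (cos_le_two_mul_cos_sq_sub_one hρ0.le (hsep j k hjk)
        ((hdiff j k).le.trans (by linarith))) hstrict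

/-! ### The coupling function realising a graph -/

section Realisation

variable {N : ℕ} {θo : Fin N → ℝ} {ρ : ℝ} {W : Fin N → Fin N → ℝ}

/-- The coupling function that is `W j k` times a bump near the phase difference of `j` and `k`. -/
noncomputable def realisingCoupling (ρ : ℝ) (θo : Fin N → ℝ) (W : Fin N → Fin N → ℝ) :
    Real.Angle → ℝ :=
  bumpSum ρ (fun i : BumpIndex N => i.elim 1 fun q => W q.1.1 q.1.2) (bumpCentre θo)

theorem torusPoint_sub (ψ : Fin N → ℝ) {j k : Fin N} (hjk : j ≠ k) :
    torusPoint θo ψ j - torusPoint θo ψ k -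
      (bumpCentre θo (some ⟨(j, k), hjk⟩) : Real.Angle) = ((ψ j - ψ k : ℝ) : Real.Angle) := by
  rw [torusPoint, torusPoint, ← Real.Angle.coe_sub, ← Real.Angle.coe_sub]
  congr 1
  simp only [bumpCentre]
  ring

theorem lt_cos_torusPoint_sub (hρ' : ρ < π / 2) {ψ : Fin N → ℝ} (hψ : ∀ i j, |ψ i - ψ j| < ρ)
    {j k : Fin N} (hjk : j ≠ k) :
    cos ρ < (torusPoint θo ψ j - torusPoint θo ψ k -
      (bumpCentre θo (some ⟨(j, k), hjk⟩) : Real.Angle)).cos := by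
  rw [torusPoint_sub, Real.Angle.cos_coe]
  exact cos_lt_cos_of_abs_lt (by linarith [Real.pi_pos]) (hψ j k)

/-- When deviations differ by less than `ρ`, each phase difference lies in its own arc and all other
bumps vanish. -/
theorem networkField_realisingCoupling (hd : AreSeparated ρ (bumpCentre θo)) (hρ : 0 < ρ)
    (hρ' : ρ < π / 2) (ω : ℝ) {ψ : Fin N → ℝ} (hψ : ∀ i j, |ψ i - ψ j| < ρ) (k : Fin N) :
    networkField ω (realisingCoupling ρ θo W) (torusPoint θo ψ) k =
      ω + ∑ j ∈ Finset.univ.erase k, W j k * oddBump ρ ((ψ j - ψ k : ℝ) : Real.Angle) := by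
  have hc : 0 < cos ρ := Real.cos_pos_of_mem_Ioo ⟨by linarith [Real.pi_pos], hρ'⟩
  unfold networkField
  congr 1
  refine Finset.sum_congr rfl fun j hj => ?_
  have hjk : j ≠ k := Finset.ne_of_mem_erase hj
  rw [realisingCoupling, hd.bumpSum_eq hc (lt_cos_torusPoint_sub hρ' hψ hjk), torusPoint_sub]
  rfl

theorem effectiveCouplingGraph_realisingCoupling (hd : AreSeparated ρ (bumpCentre θo)) (hρ : 0 < ρ)
    (hρ' : ρ < π / 2) {H : Digraph (Fin N)} (hH : H ≤ fullyConnectedGraph N)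
    (hW : ∀ j k, W j k ≠ 0 ↔ H.Adj j k) {ψ : Fin N → ℝ} (hψ : ∀ i j, |ψ i - ψ j| < ρ) :
    effectiveCouplingGraph (realisingCoupling ρ θo W) (torusPoint θo ψ) = H := by
  have hc : 0 < cos ρ := Real.cos_pos_of_mem_Ioo ⟨by linarith [Real.pi_pos], hρ'⟩
  ext j k
  show (j ≠ k ∧ _ ∉ deadZoneSet _) ↔ _
  rw [realisingCoupling, hd.deadZoneSet_bumpSum hρ hρ']
  constructor
  · rintro ⟨hjk, hnot⟩
    by_contra hadj
    refine hnot fun i hw => hd.cos_sub_lt hc (lt_cos_torusPoint_sub hρ' hψ hjk) ?_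
    rintro rfl
    exact hadj ((hW j k).1 hw)
  · intro hadj
    have hjk : j ≠ k := hH hadj
    refine ⟨hjk, fun hmem => ?_⟩
    exact (lt_cos_torusPoint_sub hρ' hψ hjk).not_gt
      (hmem (some ⟨(j, k), hjk⟩) ((hW j k).2 hadj))

theorem isRelativeEquilibrium_realisingCoupling (hd : AreSeparated ρ (bumpCentre θo)) (hρ : 0 < ρ)
    (hρ' : ρ < π / 2) (ω : ℝ) :
    IsRelativeEquilibrium ω (realisingCoupling ρ θo W) ω fun k => (θo k : Real.Angle) := by
  refine ⟨fun t k => θo k + ω * t, fun t _ k => ⟨by rw [Real.Angle.coe_add, add_comm], ?_⟩⟩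
  have hpoint : (fun k => ((ω * t : ℝ) : Real.Angle) + (θo k : Real.Angle)) =
      torusPoint θo fun _ => ω * t := by
    funext k
    rw [torusPoint, Real.Angle.coe_add, add_comm]
  beta_reduce
  rw [hpoint, networkField_realisingCoupling hd hρ hρ' ω (by simp [hρ])]
  simp only [sub_self, Real.Angle.coe_zero, oddBump_zero, mul_zero, Finset.sum_const_zero, add_zero]
  exact (((hasDerivAt_id t).const_mul ω).const_add (θo k)).hasDerivWithinAt.congr_deriv (by simp)

/-- With weight `1` on a spanning tree and small weights elsewhere, the network is dissipative. -/
theorem isDissipative_realisingCoupling (hd : AreSeparated ρ (bumpCentre θo)) (hρ : 0 < ρ)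
    (hρ' : ρ < π / 2) (ω : ℝ) {γ : Fin N → ℝ} {p : Fin N → Fin N} {r : Fin N} {a C ε : ℝ}
    (hγ : ∀ k, 0 < γ k) (hγ1 : ∀ k, γ k ≤ 1) (hpr : p r = r) (hp : ∀ k, k ≠ r → p k ≠ k)
    (ha : 0 < a)
    (hbump : ∀ u : ℝ, |u| ≤ ρ / 2 → a * u ^ 2 ≤ u * oddBump ρ (u : Real.Angle))
    (hγp : ∀ k, k ≠ r → γ k ≤ a ^ 2 / (4 * N) * γ (p k)) (hC0 : 0 < C)
    (hC : ∀ (ψ : Fin N → ℝ) (i j : Fin N), |ψ i - ψ j| ≤ C * √(treeEnergy γ p ψ))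
    (hε : 0 ≤ ε) (hε' : ε * (8 * N ^ 2 * C ^ 2) ≤ a)
    (hWtree : ∀ k, k ≠ r → W (p k) k = 1)
    (hWrest : ∀ j k, (k ≠ r → j ≠ p k) → |W j k| ≤ ε) :
    IsDissipative ω (realisingCoupling ρ θo W) θo γ p ((ρ / 2 / C) ^ 2) (a / 2) := by
  classical
  intro ψ hψ
  -- The threshold confines all phase differences to `ρ / 2`, where the bump has its linear lower
  -- bound.
  have hsqrt : √(treeEnergy γ p ψ) < ρ / 2 / C := (Real.sqrt_lt' (by positivity)).2 hψ
  have hsmall : ∀ i j, |ψ i - ψ j| < ρ / 2 := fun i j =>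
    (hC ψ i j).trans_lt (by rw [mul_comm]; exact (lt_div_iff₀ hC0).1 hsqrt)
  set h : ℝ → ℝ := fun u => oddBump ρ (u : Real.Angle) with hh
  set A : Fin N → Fin N → ℝ := fun j k => if k ≠ r ∧ j = p k then 1 else 0 with hA
  have htree : ∀ k, ∑ j ∈ Finset.univ.erase k, A j k * h (ψ j - ψ k) = -h (ψ k - ψ (p k)) := by
    intro k
    by_cases hk : k = r
    · simp [hA, hh, hk, hpr, oddBump_zero]
    · rw [Finset.sum_eq_single (p k)]
      · simp only [hA, hh, hk, ne_eq, not_false_eq_true, and_self, if_true, one_mul]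
        rw [← oddBump_neg, ← Real.Angle.coe_neg, neg_sub]
      · intro j _ hj
        simp [hA, hj]
      · intro hnot
        exact absurd (Finset.mem_erase.2 ⟨hp k hk, Finset.mem_univ _⟩) hnot
  have hfield : networkField ω (realisingCoupling ρ θo W) (torusPoint θo ψ) = fun k =>
      ω - h (ψ k - ψ (p k)) + ∑ j ∈ Finset.univ.erase k, (W j k - A j k) * h (ψ j - ψ k) := by
    funext k
    rw [networkField_realisingCoupling hd hρ hρ' ω
      (fun i j => (hsmall i j).trans (by linarith)) k]
    have h1 : ∑ j ∈ Finset.univ.erase k, (W j k - A j k) * h (ψ j - ψ k) =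
        ∑ j ∈ Finset.univ.erase k, W j k * h (ψ j - ψ k) + h (ψ k - ψ (p k)) := by
      simp only [sub_mul, Finset.sum_sub_distrib, htree, sub_neg_eq_add]
    rw [h1]
    ring
  rw [hfield]
  refine treeEnergyDeriv_le (C := C) (ε := ε) r.pos hγ hγ1 hpr ha hγp hC hε hε'
    (fun k => hbump _ (hsmall _ _).le) (fun k => abs_oddBump_le _ _) fun k => ?_
  calc |∑ j ∈ Finset.univ.erase k, (W j k - A j k) * h (ψ j - ψ k)|
      ≤ ∑ j ∈ Finset.univ.erase k, |(W j k - A j k) * h (ψ j - ψ k)| :=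
        Finset.abs_sum_le_sum_abs _ _
    _ ≤ ∑ j ∈ Finset.univ.erase k, ε * |ψ j - ψ k| := by
        refine Finset.sum_le_sum fun j _ => ?_
        rw [abs_mul]
        refine mul_le_mul ?_ (abs_oddBump_le _ _) (abs_nonneg _) hε
        by_cases hjk : k ≠ r ∧ j = p k
        · obtain ⟨hk, rfl⟩ := hjk
          simpa [hA, hk, hWtree k hk] using hε
        · simpa only [hA, if_neg hjk, sub_zero] using
            hWrest j k fun hk hj => hjk ⟨hk, hj⟩
    _ ≤ ∑ j, ε * |ψ j - ψ k| :=
        Finset.sum_le_sum_of_subset_of_nonneg (Finset.erase_subset _ _)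
          fun j _ _ => mul_nonneg hε (abs_nonneg _)
    _ = ε * ∑ j, |ψ j - ψ k| := (Finset.mul_sum _ _ _).symm

end Realisation

end DeadZones

/-! ### Choice of the weights and conclusion -/

open DeadZones

theorem mainTheorem1 (N : ℕ) (ω : ℝ) (H : Digraph (Fin N))
    (hH : H ≤ DeadZones.fullyConnectedGraph N)
    (hT : DeadZones.HasSpanningDivergingTree H) :
    ∃ g : Real.Angle → ℝ,
      DeadZones.IsCouplingFunction g ∧ DeadZones.HasSimpleDeadZones g ∧
      (DeadZones.deadZoneSet g).Nonempty ∧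
      (∃ (Ω : ℝ) (θo : Fin N → Real.Angle),
        DeadZones.IsStableRelativeEquilibrium ω g Ω θo ∧
        DeadZones.effectiveCouplingGraph g θo = H) ∧
      DeadZones.StablyRealises ω g H := by
  classical
  obtain ⟨T, hTH, hT⟩ := hT
  obtain ⟨r, p, depth, hpr, hadj, hdepth⟩ := hT.exists_parent_depth
  obtain ⟨θo, ρ, hρ, hρ', hd, hdπ, hd0⟩ := exists_areSeparated_bumpCentre N
  obtain ⟨a, ha, ha1, hbump⟩ := exists_mul_sq_le_mul_oddBump hρ hρ'.le
  have hN : (1 : ℝ) ≤ N := by exact_mod_cast r.pos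
  set s : ℝ := a ^ 2 / (4 * N) with hs
  have hs0 : 0 < s := by positivity
  have hs1 : s ≤ 1 := by
    rw [hs, div_le_one (by positivity)]
    nlinarith
  -- A factor `s` per level is exactly the decay that `treeEnergyDeriv_le` requires between a vertex
  -- and its parent.
  set γ : Fin N → ℝ := fun k => s ^ depth k with hγdef
  have hγ : ∀ k, 0 < γ k := fun k => pow_pos hs0 _
  have hγ1 : ∀ k, γ k ≤ 1 := fun k => pow_le_one₀ hs0.le hs1
  have hγp : ∀ k, k ≠ r → γ k ≤ a ^ 2 / (4 * N) * γ (p k) := fun k hk => by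
    rw [hγdef, ← hs]
    simp only [hdepth k hk]
    rw [pow_succ, mul_comm]
  obtain ⟨C, hC0, hC⟩ := exists_abs_sub_le_sqrt_treeEnergy hγ hdepth
  set ε : ℝ := a / (8 * N ^ 2 * C ^ 2) with hε
  have hε0 : 0 < ε := by positivity
  have hε' : ε * (8 * N ^ 2 * C ^ 2) ≤ a := (div_mul_cancel₀ a (by positivity)).le
  set W : Fin N → Fin N → ℝ := fun j k =>
    if T.Adj j k then 1 else if H.Adj j k then ε else 0 with hW
  have hWH : ∀ j k, W j k ≠ 0 ↔ H.Adj j k := by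
    intro j k
    simp only [hW]
    split_ifs with h1 h2
    · simpa using hTH h1
    · simpa [h2] using hε0.ne'
    · simpa using h2
  have hWtree : ∀ k, k ≠ r → W (p k) k = 1 := fun k hk => if_pos ((hadj _ _).2 ⟨hk, rfl⟩)
  have hWrest : ∀ j k, (k ≠ r → j ≠ p k) → |W j k| ≤ ε := by
    intro j k hjk
    have hnot : ¬ T.Adj j k := fun h => hjk ((hadj j k).1 h).1 ((hadj j k).1 h).2
    simp only [hW, if_neg hnot]
    split_ifs
    · exact (abs_of_pos hε0).le
    · simpa using hε0.le
  have hp : ∀ k, k ≠ r → p k ≠ k := fun k hk => hH (hTH ((hadj (p k) k).2 ⟨hk, rfl⟩))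
  have hdiss := isDissipative_realisingCoupling hd hρ hρ' ω hγ hγ1 hpr hp ha hbump hγp hC0 hC
    hε0.le hε' hWtree hWrest
  set v₀ : ℝ := (ρ / 2 / C) ^ 2 with hv₀
  have hv₀0 : 0 < v₀ := by positivity
  have ha2 : 0 < a / 2 := by positivity
  -- The extra bump `none` has weight 1 whatever `H` is. The level `v₀ / 2` leaves room below `v₀`
  -- for attraction from outside `B`.
  refine ⟨realisingCoupling ρ θo W,
    hd.isCouplingFunction_bumpSum hρ hρ' (i := none) one_ne_zero,
    hd.hasSimpleDeadZones_bumpSum hρ hρ' hdπ, ⟨0, ?_⟩,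
    ⟨ω, fun k => (θo k : Real.Angle),
      ⟨isRelativeEquilibrium_realisingCoupling hd hρ hρ' ω,
        hdiss.isAsymptoticallyStable_phaseShiftOrbit hv₀0 ha2 hγ hγ1 r hC0 hC⟩, ?_⟩,
    energySublevel θo γ p (v₀ / 2), ?_, isOpen_energySublevel _,
    hdiss.isForwardInvariant ha2 hγ (by linarith),
    hdiss.isAsymptoticallyStable_energySublevel (by linarith) (by linarith) ha2 hγ hγ1 r hC0 hC, ?_⟩
  · rw [realisingCoupling, hd.deadZoneSet_bumpSum hρ hρ']
    intro i _
    rw [zero_sub, Real.Angle.cos_neg, Real.Angle.cos_coe]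
    exact hd0 i
  · have h0 : torusPoint θo (fun _ => 0) = fun k => (θo k : Real.Angle) := by
      funext k
      rw [torusPoint, add_zero]
    rw [← h0]
    exact effectiveCouplingGraph_realisingCoupling hd hρ hρ' hH hWH (by simp [hρ])
  · exact ⟨_, phaseShiftOrbit_subset_energySublevel (by linarith)
      (torusPoint_const_mem_phaseShiftOrbit 0)⟩
  · rintro _ ⟨ψ, hψ, rfl⟩
    refine effectiveCouplingGraph_realisingCoupling hd hρ hρ' hH hWH fun i j => ?_
    have hψ' : treeEnergy γ p ψ < v₀ / 2 := hψ
    have hsqrt : √(treeEnergy γ p ψ) < ρ / 2 / C :=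
      (Real.sqrt_lt' (by positivity)).2 (by linarith)
    have := (lt_div_iff₀ hC0).1 hsqrt
    linarith [hC ψ i j]
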